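/- Let $T>0$, let $H(t)=H(t)^\dagger\in\mathbb C^{m\times m}$ and $\gamma_1(t),\dots,\gamma_K(t)\ge 0$ be twice continuously differentiable on $[0,T]$, let $L_1,\dots,L_K\in\mathbb C^{m\times m}$, and consider the Lindblad equation on $[0,T]$ $$\dot\rho(t)=-i[H(t),\rho(t)]+\sum_{k=1}^K\gamma_k(t)\Big(L_k\rho(t)L_k^\dagger-\tfrac12\{L_k^\dagger L_k,\rho(t)\}\Big).\qquad(1)$$ A density matrix is a Hermitian positive semidefinite matrix of trace one, and $\|X\|_1=\operatorname{Tr}\sqrt{X^\dagger X}$ is the trace norm. Put $A(t)=-iH(t)-\frac12\sum_k\gamma_k(t)L_k^\dagger L_k$. For an integer $N\ge1$ let $\tau=T/N$, $t_s=s\tau$, $A_s=A(t_s)$, and for $0\le n\le N-1$ let $\Phi(t_n,X)$ be one step of the full-rank exponential midpoint (FREM) scheme, $$Y=e^{\frac\tau2A_n}\Big(X+\tfrac\tau2\sum_k\gamma_k(t_n)L_kXL_k^\dagger\Big)e^{\frac\tau2A_n^\dagger},$$ $$\Phi(t_n,X)=e^{\tau A_{n+1/2}}Xe^{\tau A_{n+1/2}^\dagger}+\tau\sum_k\gamma_k(t_{n+1/2})\,e^{\frac\tau2A_{n+1/2}}L_kYL_k^\dagger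 e^{\frac\tau2A_{n+1/2}^\dagger}.$$ The normalized FREM scheme is $\rho_0=\rho(0)$, $\rho_{n+1}=\Phi(t_n,\rho_n)/\operatorname{Tr}\Phi(t_n,\rho_n)$ for $0\le n\le N-1$. (a) There is a constant $C_1>0$, depending only on $H$, $L_k$, $\gamma_k$ and $T$, such that $$\|\varrho(t_{n+1})-\Phi(t_n,\varrho(t_n))\|_1\le C_1\tau^3\qquad(2)$$ for all $N\ge1$, all $0\le n\le N-1$ and all solutions $\varrho$ of (1) on $[t_n,t_{n+1}]$ for which $\varrho(t_n)$ is a density matrix. (b) Let $C_1$ be any constant with the property in (a), let $C_2=\sum_{k=1}^K\big(\max_{0\le t\le T}\gamma_k(t)\big)\|L_k\|_1^2$, and let $C_3=\frac{C_1}{C_2}(e^{C_2T}-1)$ (read as $C_1T$ if $C_2=0$). Then for every solution $\rho$ of (1) on $[0,T]$ for which $\rho(0)$ is a density matrix, and for every $N\ge1$, the normalized FREM scheme satisfies $$\|\rho(t_n)-\rho_n\|_1\le 2C_3\,\tau^2,\qquad 0\le n\le N.$$ -/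

import Mathlib

open scoped Matrix ComplexOrder

namespace LindbladFREM

/-- The trace norm `‖X‖₁ = Tr √(X† X)`: the sum of the singular values of `X`, i.e. of the square
roots of the eigenvalues of `X† X`, counted with multiplicity. -/
noncomputable def traceNorm {m : ℕ} (X : Matrix (Fin m) (Fin m) ℂ) : ℝ :=
  ∑ j, Real.sqrt ((Matrix.isHermitian_conjTranspose_mul_self X).eigenvalues j)

/-- Hermitian positive semidefinite matrices with unit trace. -/
def IsDensity {m : ℕ} (X : Matrix (Fin m) (Fin m) ℂ) : Prop :=
  X.PosSemidef ∧ X.trace = 1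

/-- Right-hand side of the forward Lindblad equation at time `t`:
`-i [H(t), X] + ∑ₖ γₖ(t) (Lₖ X Lₖ† - ½ {Lₖ† Lₖ, X})`. -/
noncomputable def lindbladRHS {m K : ℕ} (H : ℝ → Matrix (Fin m) (Fin m) ℂ)
    (L : Fin K → Matrix (Fin m) (Fin m) ℂ) (γ : Fin K → ℝ → ℝ)
    (t : ℝ) (X : Matrix (Fin m) (Fin m) ℂ) : Matrix (Fin m) (Fin m) ℂ :=
  (-Complex.I) • (H t * X - X * H t) +
    ∑ k, (γ k t : ℂ) • (L k * X * (L k)ᴴ -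
      (1 / 2 : ℂ) • ((L k)ᴴ * L k * X + X * ((L k)ᴴ * L k)))

/-- `ρ` solves the forward Lindblad equation on `[a, b]` (entrywise derivatives, one-sided at the
end points). -/
def IsLindbladSolution {m K : ℕ} (H : ℝ → Matrix (Fin m) (Fin m) ℂ)
    (L : Fin K → Matrix (Fin m) (Fin m) ℂ) (γ : Fin K → ℝ → ℝ)
    (a b : ℝ) (ρ : ℝ → Matrix (Fin m) (Fin m) ℂ) : Prop :=
  ∀ t ∈ Set.Icc a b, ∀ i j,
    HasDerivWithinAt (fun s => ρ s i j) (lindbladRHS H L γ t (ρ t) i j) (Set.Icc a b) t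

/-- `A(t) = -i H(t) - ½ ∑ₖ γₖ(t) Lₖ† Lₖ`. -/
noncomputable def generator {m K : ℕ} (H : ℝ → Matrix (Fin m) (Fin m) ℂ)
    (L : Fin K → Matrix (Fin m) (Fin m) ℂ) (γ : Fin K → ℝ → ℝ)
    (t : ℝ) : Matrix (Fin m) (Fin m) ℂ :=
  (-Complex.I) • H t - (1 / 2 : ℂ) • ∑ k, (γ k t : ℂ) • ((L k)ᴴ * L k)

/-- The half-step value
`e^{τ/2 A(t)} (X + τ/2 ∑ₖ γₖ(t) Lₖ X Lₖ†) e^{τ/2 A(t)†}`. -/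
noncomputable def fremHalf {m K : ℕ} (H : ℝ → Matrix (Fin m) (Fin m) ℂ)
    (L : Fin K → Matrix (Fin m) (Fin m) ℂ) (γ : Fin K → ℝ → ℝ)
    (τ t : ℝ) (X : Matrix (Fin m) (Fin m) ℂ) : Matrix (Fin m) (Fin m) ℂ :=
  NormedSpace.exp (((τ / 2 : ℝ) : ℂ) • generator H L γ t) *
    (X + ((τ / 2 : ℝ) : ℂ) • ∑ k, (γ k t : ℂ) • (L k * X * (L k)ᴴ)) *
    NormedSpace.exp (((τ / 2 : ℝ) : ℂ) • (generator H L γ t)ᴴ)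

/-- One step `Φ(t, X)` of the full-rank exponential midpoint scheme with step size `τ`, where
`B = A(t + τ/2)` and `Y` is the half-step value:
`e^{τ B} X e^{τ B†} + τ ∑ₖ γₖ(t + τ/2) e^{τ/2 B} Lₖ Y Lₖ† e^{τ/2 B†}`. -/
noncomputable def fremStep {m K : ℕ} (H : ℝ → Matrix (Fin m) (Fin m) ℂ)
    (L : Fin K → Matrix (Fin m) (Fin m) ℂ) (γ : Fin K → ℝ → ℝ)
    (τ t : ℝ) (X : Matrix (Fin m) (Fin m) ℂ) : Matrix (Fin m) (Fin m) ℂ :=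
  NormedSpace.exp ((τ : ℂ) • generator H L γ (t + τ / 2)) * X *
      NormedSpace.exp ((τ : ℂ) • (generator H L γ (t + τ / 2))ᴴ) +
    (τ : ℂ) • ∑ k, (γ k (t + τ / 2) : ℂ) •
      (NormedSpace.exp (((τ / 2 : ℝ) : ℂ) • generator H L γ (t + τ / 2)) *
        (L k * fremHalf H L γ τ t X * (L k)ᴴ) *
        NormedSpace.exp (((τ / 2 : ℝ) : ℂ) • (generator H L γ (t + τ / 2))ᴴ))

/-- The normalized scheme with step size `τ` on the grid `tₙ = n τ`, started at `X₀`: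
`ρₙ₊₁ = Φ(tₙ, ρₙ) / Tr Φ(tₙ, ρₙ)`. -/
noncomputable def normalizedFREM {m K : ℕ} (H : ℝ → Matrix (Fin m) (Fin m) ℂ)
    (L : Fin K → Matrix (Fin m) (Fin m) ℂ) (γ : Fin K → ℝ → ℝ)
    (τ : ℝ) (X₀ : Matrix (Fin m) (Fin m) ℂ) : ℕ → Matrix (Fin m) (Fin m) ℂ
  | 0 => X₀
  | n + 1 =>
    (fremStep H L γ τ (n * τ) (normalizedFREM H L γ τ X₀ n)).trace⁻¹ •
      fremStep H L γ τ (n * τ) (normalizedFREM H L γ τ X₀ n)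

/-- `C₁` is a truncation error constant: on every uniform grid `tₙ = n τ`, `τ = T / N`, of `[0, T]`,
one (unnormalized) step started on any solution of the Lindblad equation that is a density
matrix at time `tₙ` has trace norm error at most `C₁ τ³`. -/
def IsTruncationConst {m K : ℕ} (H : ℝ → Matrix (Fin m) (Fin m) ℂ)
    (L : Fin K → Matrix (Fin m) (Fin m) ℂ) (γ : Fin K → ℝ → ℝ) (T C₁ : ℝ) : Prop :=
  ∀ N : ℕ, 0 < N → ∀ n : ℕ, n < N → ∀ ρ : ℝ → Matrix (Fin m) (Fin m) ℂ,
    IsLindbladSolution H L γ (n * (T / N)) ((n + 1) * (T / N)) ρ →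
    IsDensity (ρ (n * (T / N))) →
    traceNorm (ρ ((n + 1) * (T / N)) - fremStep H L γ (T / N) (n * (T / N)) (ρ (n * (T / N))))
      ≤ C₁ * (T / N) ^ 3

/-- `C₂ = ∑ₖ (max_{0 ≤ t ≤ T} γₖ(t)) ‖Lₖ‖₁²`. -/
noncomputable def stabilityConst {m K : ℕ} (L : Fin K → Matrix (Fin m) (Fin m) ℂ)
    (γ : Fin K → ℝ → ℝ) (T : ℝ) : ℝ :=
  ∑ k, sSup (γ k '' Set.Icc 0 T) * traceNorm (L k) ^ 2

/-- `C₃ = (C₁ / C₂) (e^{C₂ T} - 1)`, to be read as its limit `C₁ T` if `C₂ = 0`. -/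
noncomputable def errorConst (C₁ C₂ T : ℝ) : ℝ :=
  if C₂ = 0 then C₁ * T else C₁ / C₂ * (Real.exp (C₂ * T) - 1)

end LindbladFREM

/-!
Write the Lindblad equation as `ρ' = (D(t) + J(t)) ρ`, where `D(t) X = A(t) X + X A(t)†` is the
no-jump part and `J(t) X = ∑ₖ γₖ(t) Lₖ X Lₖ†` the jump part.

Local error: to second order in `τ`, both the exact flow over `[t, t + τ]` and one FREM step expand
as `1 + τ B + τ² B² / 2` with `B = (D + J)(t + τ / 2)`. The midpoint absorbs the contribution of the
time dependence of the coefficients, so the two differ by `O(τ³)`, uniformly in `t`.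

Stability: `A(t) + A(t)† ≤ 0` makes `e^{τ D}` a contraction for the trace norm, and
`‖J(t)‖ ≤ C₂`, so a step expands trace norms by at most `1 + C₂ τ + (C₂ τ)² / 2 ≤ e^{C₂ τ}`.
Summing the propagated local errors gives the bound `C₃ τ²` for the scheme without normalization.

Positivity: every step is a sum of completely positive maps, and the exact solution, as a limit of
such schemes, stays positive; this is what allows the hypothesis on `C₁`, which concerns density
matrices only, to be applied at every grid point.

Normalization: by linearity of the step, the normalized iterate is the iterate `X` without
normalization divided by its trace. Since `X` is positive, `‖X - X / Tr X‖₁ = |Tr X - 1|`, which is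
again at most `‖ρ - X‖₁`; hence the factor `2`.
-/

namespace LindbladFREM

open Set Filter Asymptotics

section Flow

variable {F : Type*} [NormedAddCommGroup F] [NormedSpace ℝ F]

theorem norm_sub_le_mul_pow_succ {f f' : ℝ → F} {a b C : ℝ} (k : ℕ) (hC : 0 ≤ C)
    (hf : ∀ u ∈ Icc a b, HasDerivWithinAt f (f' u) (Icc a b) u)
    (hf' : ∀ u ∈ Icc a b, ‖f' u‖ ≤ C * (u - a) ^ k) {u : ℝ} (hu : u ∈ Icc a b) :
    ‖f u - f a‖ ≤ C * (u - a) ^ (k + 1) := by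
  have hsub : Icc a u ⊆ Icc a b := Icc_subset_Icc_right hu.2
  have hbound : ∀ v ∈ Icc a u, ‖f' v‖ ≤ C * (u - a) ^ k := fun v hv => by
    refine (hf' v (hsub hv)).trans ?_
    gcongr
    exacts [sub_nonneg.2 hv.1, hv.2]
  have := (convex_Icc a u).norm_image_sub_le_of_norm_hasDerivWithin_le
    (fun v hv => (hf v (hsub hv)).mono hsub) hbound (left_mem_Icc.2 hu.1) (right_mem_Icc.2 hu.1)
  rwa [Real.norm_of_nonneg (sub_nonneg.2 hu.1), mul_assoc, ← pow_succ] at this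

/-- Uniform first order Taylor estimates for `f` on `s`, all with the same constant `K`; `f'` plays
the role of the derivative of `f`. -/
structure HasTaylorBound (f f' : ℝ → F) (s : Set ℝ) (K : ℝ) : Prop where
  nonneg : 0 ≤ K
  norm_le : ∀ x ∈ s, ‖f x‖ ≤ K
  norm_deriv_le : ∀ x ∈ s, ‖f' x‖ ≤ K
  norm_sub_le : ∀ x ∈ s, ∀ y ∈ s, x ≤ y → ‖f y - f x‖ ≤ K * (y - x)
  norm_sub_sub_le : ∀ x ∈ s, ∀ y ∈ s, x ≤ y → ‖f y - f x - (y - x) • f' x‖ ≤ K * (y - x) ^ 2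

theorem HasTaylorBound.mono {f f' : ℝ → F} {s s' : Set ℝ} {K : ℝ} (h : HasTaylorBound f f' s K)
    (hs : s' ⊆ s) : HasTaylorBound f f' s' K where
  nonneg := h.nonneg
  norm_le x hx := h.norm_le x (hs hx)
  norm_deriv_le x hx := h.norm_deriv_le x (hs hx)
  norm_sub_le x hx y hy := h.norm_sub_le x (hs hx) y (hs hy)
  norm_sub_sub_le x hx y hy := h.norm_sub_sub_le x (hs hx) y (hs hy)

theorem exists_hasTaylorBound {f : ℝ → F} {a b : ℝ} (hab : a < b)
    (hf : ContDiffOn ℝ 2 f (Icc a b)) :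
    ∃ K, HasTaylorBound f (derivWithin f (Icc a b)) (Icc a b) K := by
  set f' := derivWithin f (Icc a b)
  have hu : UniqueDiffOn ℝ (Icc a b) := uniqueDiffOn_Icc hab
  have hf' : ContDiffOn ℝ 1 f' (Icc a b) := hf.derivWithin hu (by norm_num)
  have hf'' : ContDiffOn ℝ 0 (derivWithin f' (Icc a b)) (Icc a b) :=
    hf'.derivWithin hu (by norm_num)
  have deriv_f : ∀ u ∈ Icc a b, HasDerivWithinAt f (f' u) (Icc a b) u := fun u hu =>
    (hf.differentiableOn (by norm_num) u hu).hasDerivWithinAt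
  have deriv_f' : ∀ u ∈ Icc a b, HasDerivWithinAt f' (derivWithin f' (Icc a b) u) (Icc a b) u :=
    fun u hu => (hf'.differentiableOn (by norm_num) u hu).hasDerivWithinAt
  obtain ⟨K₀, h₀⟩ := isCompact_Icc.exists_bound_of_continuousOn hf.continuousOn
  obtain ⟨K₁, h₁⟩ := isCompact_Icc.exists_bound_of_continuousOn hf'.continuousOn
  obtain ⟨K₂, h₂⟩ := isCompact_Icc.exists_bound_of_continuousOn hf''.continuousOn
  set K := max K₀ (max K₁ K₂)
  have hK₁ : K₁ ≤ K := (le_max_left _ _).trans (le_max_right _ _)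
  have hK₂ : K₂ ≤ K := (le_max_right _ _).trans (le_max_right _ _)
  have hK : 0 ≤ K :=
    (norm_nonneg _).trans ((h₀ a (left_mem_Icc.2 hab.le)).trans (le_max_left _ _))
  have sub_le : ∀ {g g' : ℝ → F}, (∀ u ∈ Icc a b, HasDerivWithinAt g (g' u) (Icc a b) u) →
      (∀ u ∈ Icc a b, ‖g' u‖ ≤ K) → ∀ x ∈ Icc a b, ∀ y ∈ Icc a b, x ≤ y →
      ‖g y - g x‖ ≤ K * (y - x) := fun hg hg' x hx y hy hxy => by
    have := (convex_Icc a b).norm_image_sub_le_of_norm_hasDerivWithin_le hg hg' hx hy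
    rwa [Real.norm_of_nonneg (sub_nonneg.2 hxy)] at this
  refine ⟨K, hK, fun x hx => (h₀ x hx).trans (le_max_left _ _), fun x hx => (h₁ x hx).trans hK₁,
    sub_le deriv_f fun u hu => (h₁ u hu).trans hK₁, fun x hx y hy hxy => ?_⟩
  have hsub : Icc x y ⊆ Icc a b := Icc_subset_Icc hx.1 hy.2
  have := norm_sub_le_mul_pow_succ (f := fun u => f u - (u - x) • f' x)
    (f' := fun u => f' u - (1 : ℝ) • f' x) 1 hK
    (fun u hu => ((deriv_f u (hsub hu)).mono hsub).sub
      (((hasDerivWithinAt_id u _).sub_const x).smul_const _))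
    (fun u hu => by
      rw [one_smul, pow_one]
      exact sub_le deriv_f' (fun v hv => (h₂ v hv).trans hK₂) x hx u (hsub hu) hu.1)
    (right_mem_Icc.2 hxy)
  rwa [sub_self, zero_smul, sub_zero, sub_right_comm] at this

variable {Λ Λ' : ℝ → F →L[ℝ] F} {ρ : ℝ → F} {a b K R : ℝ}

theorem norm_le_of_linear_ode (hK : ∀ u ∈ Icc a b, ‖Λ u‖ ≤ K)
    (hρ : ∀ u ∈ Icc a b, HasDerivWithinAt ρ (Λ u (ρ u)) (Icc a b) u) {u : ℝ} (hu : u ∈ Icc a b) :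
    ‖ρ u‖ ≤ ‖ρ a‖ * Real.exp (K * (u - a)) := by
  have := norm_le_gronwallBound_of_norm_deriv_right_le (f' := fun u => Λ u (ρ u)) (ε := 0)
    (fun x hx => (hρ x hx).continuousWithinAt)
    (fun x hx => (hρ x (Ico_subset_Icc_self hx)).mono_of_mem_nhdsWithin
      (Icc_mem_nhdsGE_of_mem hx)) le_rfl
    (fun x hx => by
      rw [add_zero]
      exact (Λ x).le_of_opNorm_le (hK x (Ico_subset_Icc_self hx)) _) u hu
  rwa [gronwallBound_ε0] at this

theorem flow_sub_le (hΛ : HasTaylorBound Λ Λ' (Icc a b) K)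
    (hρ : ∀ u ∈ Icc a b, HasDerivWithinAt ρ (Λ u (ρ u)) (Icc a b) u)
    (hR : ∀ u ∈ Icc a b, ‖ρ u‖ ≤ R) {u : ℝ} (hu : u ∈ Icc a b) :
    ‖ρ u - ρ a‖ ≤ K * R * (u - a) := by
  have hR₀ : 0 ≤ R := (norm_nonneg _).trans (hR u hu)
  have := norm_sub_le_mul_pow_succ 0 (mul_nonneg hΛ.nonneg hR₀) hρ (fun v hv => by
    simpa using (Λ v).le_of_opNorm_le_of_le (hΛ.norm_le v hv) (hR v hv)) hu
  simpa using this

theorem flow_sub_linear_le (hΛ : HasTaylorBound Λ Λ' (Icc a b) K)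
    (hρ : ∀ u ∈ Icc a b, HasDerivWithinAt ρ (Λ u (ρ u)) (Icc a b) u)
    (hR : ∀ u ∈ Icc a b, ‖ρ u‖ ≤ R) {u : ℝ} (hu : u ∈ Icc a b) :
    ‖ρ u - ρ a - (u - a) • Λ a (ρ a)‖ ≤ K * (1 + K) * R * (u - a) ^ 2 := by
  have hK := hΛ.nonneg
  have hR₀ : 0 ≤ R := (norm_nonneg _).trans (hR u hu)
  have ha : a ∈ Icc a b := left_mem_Icc.2 (hu.1.trans hu.2)
  have deriv_sub_le : ∀ v ∈ Icc a b,
      ‖Λ v (ρ v) - (1 : ℝ) • Λ a (ρ a)‖ ≤ K * (1 + K) * R * (v - a) ^ 1 := fun v hv => by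
    have split : Λ v (ρ v) - (1 : ℝ) • Λ a (ρ a) = (Λ v - Λ a) (ρ v) + Λ a (ρ v - ρ a) := by simp
    calc _ ≤ K * (v - a) * R + K * (K * R * (v - a)) := by
          rw [split]
          exact norm_add_le_of_le
            ((Λ v - Λ a).le_of_opNorm_le_of_le (hΛ.norm_sub_le a ha v hv hv.1) (hR v hv))
            ((Λ a).le_of_opNorm_le_of_le (hΛ.norm_le a ha) (flow_sub_le hΛ hρ hR hv))
      _ = _ := by ring
  have := norm_sub_le_mul_pow_succ (f := fun v => ρ v - (v - a) • Λ a (ρ a)) 1 (by positivity)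
    (fun v hv => (hρ v hv).sub (((hasDerivWithinAt_id v _).sub_const a).smul_const _))
    deriv_sub_le hu
  rwa [sub_self, zero_smul, sub_zero, sub_right_comm] at this

theorem flow_sub_quadratic_le (hΛ : HasTaylorBound Λ Λ' (Icc a b) K)
    (hρ : ∀ u ∈ Icc a b, HasDerivWithinAt ρ (Λ u (ρ u)) (Icc a b) u)
    (hR : ∀ u ∈ Icc a b, ‖ρ u‖ ≤ R) {u : ℝ} (hu : u ∈ Icc a b) :
    ‖ρ u - ρ a - (u - a) • Λ a (ρ a) - ((u - a) ^ 2 / 2) • (Λ' a (ρ a) + Λ a (Λ a (ρ a)))‖ ≤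
      K * (1 + K) ^ 2 * R * (u - a) ^ 3 := by
  have hK := hΛ.nonneg
  have hR₀ : 0 ≤ R := (norm_nonneg _).trans (hR u hu)
  have ha : a ∈ Icc a b := left_mem_Icc.2 (hu.1.trans hu.2)
  set c := Λ' a (ρ a) + Λ a (Λ a (ρ a)) with hc
  have deriv_sub_le : ∀ v ∈ Icc a b, ‖Λ v (ρ v) - (1 : ℝ) • Λ a (ρ a) - (v - a) • c‖ ≤
      K * (1 + K) ^ 2 * R * (v - a) ^ 2 := fun v hv => by
    have hva : 0 ≤ v - a := sub_nonneg.2 hv.1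
    have split : Λ v (ρ v) - (1 : ℝ) • Λ a (ρ a) - (v - a) • c =
        (Λ v - Λ a - (v - a) • Λ' a) (ρ v) + (v - a) • Λ' a (ρ v - ρ a) +
          Λ a (ρ v - ρ a - (v - a) • Λ a (ρ a)) := by
      simp only [hc, map_sub, map_smul, _root_.sub_apply, _root_.smul_apply]
      module
    have h₁ := (Λ v - Λ a - (v - a) • Λ' a).le_of_opNorm_le_of_le
      (hΛ.norm_sub_sub_le a ha v hv hv.1) (hR v hv)
    have h₂ := (Λ' a).le_of_opNorm_le_of_le (hΛ.norm_deriv_le a ha) (flow_sub_le hΛ hρ hR hv)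
    have h₃ := (Λ a).le_of_opNorm_le_of_le (hΛ.norm_le a ha) (flow_sub_linear_le hΛ hρ hR hv)
    calc _ ≤ K * (v - a) ^ 2 * R + (v - a) * (K * (K * R * (v - a))) +
          K * (K * (1 + K) * R * (v - a) ^ 2) := by
          rw [split]
          refine norm_add_le_of_le (norm_add_le_of_le h₁ ?_) h₃
          rw [norm_smul, Real.norm_of_nonneg hva]
          exact mul_le_mul_of_nonneg_left h₂ hva
      _ = _ := by ring
  have hasDeriv : ∀ v ∈ Icc a b,
      HasDerivWithinAt (fun v => ρ v - (v - a) • Λ a (ρ a) - ((v - a) ^ 2 / 2) • c)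
        (Λ v (ρ v) - (1 : ℝ) • Λ a (ρ a) - (v - a) • c) (Icc a b) v := fun v hv => by
    refine ((hρ v hv).sub (((hasDerivWithinAt_id v _).sub_const a).smul_const _)).sub
      (HasDerivWithinAt.smul_const ?_ c)
    simpa using ((((hasDerivAt_id v).sub_const a).pow 2).div_const 2).hasDerivWithinAt
  have := norm_sub_le_mul_pow_succ 2 (by positivity) hasDeriv deriv_sub_le hu
  simp only [sub_self, zero_smul, sub_zero, ne_eq, OfNat.ofNat_ne_zero, not_false_eq_true, zero_pow,
    zero_div] at this
  convert this using 2
  abel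

/-- The quadratic Taylor polynomial of `exp (τ B)` in `τ`: the common expansion of the flow and of
the scheme when `B` is the generator at the midpoint of the step. -/
noncomputable def expTaylorTwo {𝔸 : Type*} [Ring 𝔸] [Module ℝ 𝔸] (B : 𝔸) (τ : ℝ) : 𝔸 :=
  1 + τ • B + (τ ^ 2 / 2) • B ^ 2

theorem HasTaylorBound.norm_midpoint_sub_quadratic_le {τ : ℝ}
    (hΛ : HasTaylorBound Λ Λ' (Icc a (a + τ)) K) (hτ : 0 ≤ τ) {x : F} (hx : ‖x‖ ≤ R) :
    ‖x + τ • Λ a x + (τ ^ 2 / 2) • (Λ' a x + Λ a (Λ a x)) -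
        expTaylorTwo (Λ (a + τ / 2)) τ x‖ ≤
      (K / 4 + K ^ 2 / 2) * R * τ ^ 3 := by
  have ha : a ∈ Icc a (a + τ) := ⟨le_rfl, by linarith⟩
  have hs : a + τ / 2 ∈ Icc a (a + τ) := ⟨by linarith, by linarith⟩
  have lip := hΛ.norm_sub_le a ha _ hs hs.1
  have taylor := hΛ.norm_sub_sub_le a ha _ hs hs.1
  rw [add_sub_cancel_left] at lip taylor
  set A := Λ a
  set B := Λ (a + τ / 2)
  have split : x + τ • A x + (τ ^ 2 / 2) • (Λ' a x + A (A x)) -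
      expTaylorTwo B τ x =
      -(τ • (B - A - (τ / 2) • Λ' a) x) - (τ ^ 2 / 2) • (B ((B - A) x) + (B - A) (A x)) := by
    simp only [expTaylorTwo, sq, map_sub, _root_.sub_apply, _root_.smul_apply, _root_.add_apply,
      one_apply_eq_self, mul_apply_eq_comp]
    module
  have h₁ := (B - A - (τ / 2) • Λ' a).le_of_opNorm_le_of_le taylor hx
  have h₂ := norm_add_le_of_le
    (B.le_of_opNorm_le_of_le (hΛ.norm_le _ hs) ((B - A).le_of_opNorm_le_of_le lip hx))
    ((B - A).le_of_opNorm_le_of_le lip (A.le_of_opNorm_le_of_le (hΛ.norm_le a ha) hx))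
  calc _ ≤ τ * (K * (τ / 2) ^ 2 * R) +
        τ ^ 2 / 2 * (K * (K * (τ / 2) * R) + K * (τ / 2) * (K * R)) := by
        rw [split]
        refine norm_sub_le_of_le ?_ ?_
        · rw [norm_neg, norm_smul, Real.norm_of_nonneg hτ]
          gcongr
        · rw [norm_smul, Real.norm_of_nonneg (by positivity)]
          gcongr
    _ = _ := by ring

theorem exists_norm_flow_sub_midpoint_le {T : ℝ} (hT : 0 < T)
    (hΛ : ContDiffOn ℝ 2 Λ (Icc 0 T)) (M : ℝ) :
    ∃ C, ∀ (t τ : ℝ) (ρ : ℝ → F), 0 ≤ t → 0 ≤ τ → t + τ ≤ T →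
      (∀ u ∈ Icc t (t + τ), HasDerivWithinAt ρ (Λ u (ρ u)) (Icc t (t + τ)) u) → ‖ρ t‖ ≤ M →
      ‖ρ (t + τ) - expTaylorTwo (Λ (t + τ / 2)) τ (ρ t)‖ ≤ C * τ ^ 3 := by
  obtain ⟨K, hK⟩ := exists_hasTaylorBound hT hΛ
  set R := M * Real.exp (K * T) with hR
  refine ⟨K * (1 + K) ^ 2 * R + (K / 4 + K ^ 2 / 2) * R, fun t τ ρ ht hτ htT hρ hM => ?_⟩
  have hKt := hK.mono (Icc_subset_Icc ht htT)
  have ρ_le : ∀ u ∈ Icc t (t + τ), ‖ρ u‖ ≤ R := fun u hu => by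
    refine (norm_le_of_linear_ode hKt.norm_le hρ hu).trans ?_
    have : u - t ≤ T := by linarith [hu.2]
    have := hK.nonneg
    have : 0 ≤ M := (norm_nonneg _).trans hM
    rw [hR]
    gcongr
  have htτ : t ≤ t + τ := le_add_of_nonneg_right hτ
  have h₁ := flow_sub_quadratic_le hKt hρ ρ_le (right_mem_Icc.2 htτ)
  have h₂ := hKt.norm_midpoint_sub_quadratic_le hτ (ρ_le t (left_mem_Icc.2 htτ))
  rw [add_sub_cancel_left] at h₁
  rw [add_mul]
  refine le_of_eq_of_le (congrArg norm ?_) (norm_add_le_of_le h₁ h₂)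
  abel

end Flow

section Scheme

open NormedSpace (exp)

variable {𝔸 : Type*} [NormedRing 𝔸] [NormedAlgebra ℝ 𝔸]

/-- One step of the exponential midpoint scheme for `ρ' = (A + J) ρ` as an element of an algebra:
only `A` is exponentiated, `A`, `J` are the coefficients at the midpoint of the step and `A₁`, `J₁`
those at its left end. -/
noncomputable def expMidpointStep (A J A₁ J₁ : 𝔸) (τ : ℝ) : 𝔸 :=
  exp (τ • A) + τ • (exp ((τ / 2) • A) * (J * (exp ((τ / 2) • A₁) * (1 + (τ / 2) • J₁))))

theorem exists_norm_exp_sub_sum_le [CompleteSpace 𝔸] (r : ℝ) (n : ℕ) :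
    ∃ C, ∀ x : 𝔸, ‖x‖ ≤ r →
      ‖exp x - ∑ k ∈ Finset.range n, (k.factorial : ℝ)⁻¹ • x ^ k‖ ≤ C * ‖x‖ ^ n := by
  set r' : NNReal := Real.toNNReal r + 1
  obtain ⟨a, -, C, -, h⟩ := (NormedSpace.exp_hasFPowerSeriesOnBall (𝕂 := ℝ)
    (𝔸 := 𝔸)).uniform_geometric_approx' (r' := r') ENNReal.coe_lt_top
  refine ⟨C * (a / r') ^ n, fun x hx => ?_⟩
  have hx' : x ∈ Metric.ball (0 : 𝔸) r' := by
    rw [mem_ball_zero_iff, NNReal.coe_add, NNReal.coe_one]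
    linarith [Real.le_coe_toNNReal r]
  have := h x hx' n
  simp only [zero_add, FormalMultilinearSeries.partialSum, NormedSpace.expSeries_apply_eq] at this
  exact this.trans_eq (by ring)

variable {ι : Type*} {l : Filter ι} {τ : ι → ℝ}

theorem isBigO_exp_smul_sub_sum [CompleteSpace 𝔸] {B : ι → 𝔸} (hτ : τ =O[l] fun _ => (1 : ℝ))
    (hB : B =O[l] fun _ => (1 : ℝ)) (n : ℕ) :
    (fun i => exp (τ i • B i) - ∑ k ∈ Finset.range n, (k.factorial : ℝ)⁻¹ • (τ i • B i) ^ k)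
      =O[l] fun i => τ i ^ n := by
  have bounded : (fun i => τ i • B i) =O[l] fun _ => (1 : ℝ) := by simpa using hτ.smul hB
  have small : (fun i => τ i • B i) =O[l] τ := by simpa using (isBigO_refl τ l).smul hB
  obtain ⟨r, hr⟩ := bounded.bound
  obtain ⟨C, hC⟩ := exists_norm_exp_sub_sum_le (𝔸 := 𝔸) r n
  refine IsBigO.trans (IsBigO.of_bound C ?_) (small.norm_left.pow n)
  filter_upwards [hr] with i hi
  rw [norm_pow, norm_norm]
  exact hC _ (by simpa using hi)

/-- `f = a + τ b + O(τ²)` along `l`, with bounded coefficients `a` and `b`. -/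
structure HasLinearExpansion (l : Filter ι) (τ : ι → ℝ) (f a b : ι → 𝔸) : Prop where
  isBigO_zeroth : a =O[l] fun _ => (1 : ℝ)
  isBigO_first : b =O[l] fun _ => (1 : ℝ)
  isBigO_sub : (fun i => f i - (a i + τ i • b i)) =O[l] fun i => τ i ^ 2

namespace HasLinearExpansion

variable {f a b f' a' b' : ι → 𝔸}

theorem of_isBigO (ha : a =O[l] fun _ => (1 : ℝ)) : HasLinearExpansion l τ a a 0 where
  isBigO_zeroth := ha
  isBigO_first := isBigO_zero _ _
  isBigO_sub := by simpa using isBigO_zero _ _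

theorem one_add_smul (hb : b =O[l] fun _ => (1 : ℝ)) :
    HasLinearExpansion l τ (fun i => 1 + τ i • b i) 1 b where
  isBigO_zeroth := isBigO_const_const _ one_ne_zero _
  isBigO_first := hb
  isBigO_sub := by simpa using isBigO_zero _ _

theorem exp_smul [CompleteSpace 𝔸] (hτ : τ =O[l] fun _ => (1 : ℝ)) (hb : b =O[l] fun _ => (1 : ℝ)) :
    HasLinearExpansion l τ (fun i => exp (τ i • b i)) 1 b where
  isBigO_zeroth := isBigO_const_const _ one_ne_zero _
  isBigO_first := hb
  isBigO_sub := by simpa [Finset.sum_range_succ] using isBigO_exp_smul_sub_sum hτ hb 2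

theorem congr_first (h : HasLinearExpansion l τ f a b) (hb' : b' =O[l] fun _ => (1 : ℝ))
    (hb : (fun i => b i - b' i) =O[l] τ) : HasLinearExpansion l τ f a b' where
  isBigO_zeroth := h.isBigO_zeroth
  isBigO_first := hb'
  isBigO_sub := by
    have := ((isBigO_refl τ l).smul hb).congr_right (g₂ := fun i => τ i ^ 2) fun i => (sq _).symm
    refine (h.isBigO_sub.add this).congr_left fun i => ?_
    rw [smul_sub]
    abel

theorem isBigO_one (h : HasLinearExpansion l τ f a b) (hτ : τ =O[l] fun _ => (1 : ℝ)) :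
    f =O[l] fun _ => (1 : ℝ) := by
  have sub_bounded := h.isBigO_sub.trans ((hτ.pow 2).congr_right fun _ => one_pow 2)
  have smul_bounded : (fun i => τ i • b i) =O[l] fun _ => (1 : ℝ) := by
    simpa using hτ.smul h.isBigO_first
  exact (sub_bounded.add (h.isBigO_zeroth.add smul_bounded)).congr_left fun i => sub_add_cancel _ _

theorem mul (h : HasLinearExpansion l τ f a b) (h' : HasLinearExpansion l τ f' a' b')
    (hτ : τ =O[l] fun _ => (1 : ℝ)) :
    HasLinearExpansion l τ (fun i => f i * f' i) (fun i => a i * a' i)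
      (fun i => a i * b' i + b i * a' i) where
  isBigO_zeroth := by simpa using h.isBigO_zeroth.mul h'.isBigO_zeroth
  isBigO_first := by
    simpa using (h.isBigO_zeroth.mul h'.isBigO_first).add (h.isBigO_first.mul h'.isBigO_zeroth)
  isBigO_sub := by
    have smul_bounded : (fun i => τ i • b i) =O[l] fun _ => (1 : ℝ) := by
      simpa using hτ.smul h.isBigO_first
    have left : (fun i => (f i - (a i + τ i • b i)) * f' i) =O[l] fun i => τ i ^ 2 := by
      simpa using h.isBigO_sub.mul (h'.isBigO_one hτ)
    have right : (fun i => (a i + τ i • b i) * (f' i - (a' i + τ i • b' i)))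
        =O[l] fun i => τ i ^ 2 := by
      simpa using (h.isBigO_zeroth.add smul_bounded).mul h'.isBigO_sub
    have cross : (fun i => τ i ^ 2 • (b i * b' i)) =O[l] fun i => τ i ^ 2 := by
      simpa using (isBigO_refl (fun i => τ i ^ 2) l).smul (h.isBigO_first.mul h'.isBigO_first)
    refine ((left.add right).add cross).congr_left fun i => ?_
    simp only [mul_add, add_mul, mul_sub, sub_mul, smul_mul_assoc, mul_smul_comm]
    module

end HasLinearExpansion

theorem isBigO_expMidpointStep_sub [CompleteSpace 𝔸] {A J A₁ J₁ : ι → 𝔸}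
    (hτ : τ =O[l] fun _ => (1 : ℝ)) (hA : A =O[l] fun _ => (1 : ℝ))
    (hJ : J =O[l] fun _ => (1 : ℝ)) (hA₁ : (fun i => A₁ i - A i) =O[l] τ)
    (hJ₁ : (fun i => J₁ i - J i) =O[l] τ) :
    (fun i => expMidpointStep (A i) (J i) (A₁ i) (J₁ i) (τ i) - expTaylorTwo (A i + J i) (τ i))
      =O[l] fun i => τ i ^ 3 := by
  have half_eq : (fun i => 2⁻¹ * τ i) = fun i => τ i / 2 := funext fun i => inv_mul_eq_div _ _
  have hσ : (fun i => τ i / 2) =O[l] fun _ => (1 : ℝ) := half_eq ▸ hτ.const_mul_left _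
  have le_half : τ =O[l] fun i => τ i / 2 :=
    half_eq ▸ (isBigO_refl τ l).const_mul_right (by norm_num)
  have half_le : (fun i => τ i / 2) =O[l] τ := half_eq ▸ (isBigO_refl τ l).const_mul_left _
  have bounded_left : ∀ {B B₁ : ι → 𝔸}, B =O[l] (fun _ => (1 : ℝ)) →
      (fun i => B₁ i - B i) =O[l] τ → B₁ =O[l] fun _ => (1 : ℝ) := fun hB hB₁ =>
    ((hB₁.trans hτ).add hB).congr_left fun i => sub_add_cancel _ _
  have jump := (HasLinearExpansion.exp_smul hσ hA).mul
    ((HasLinearExpansion.of_isBigO hJ).mul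
      ((((HasLinearExpansion.exp_smul hσ (bounded_left hA hA₁)).congr_first hA
        (hA₁.trans le_half))).mul
        ((HasLinearExpansion.one_add_smul (bounded_left hJ hJ₁)).congr_first hJ
          (hJ₁.trans le_half)) hσ) hσ) hσ
  have jump_part := ((isBigO_refl τ l).smul (jump.isBigO_sub.trans (half_le.pow 2))).congr_right
    (g₂ := fun i => τ i ^ 3) fun i => (pow_succ' _ _).symm
  refine ((isBigO_exp_smul_sub_sum hτ hA 3).add jump_part).congr_left fun i => ?_
  simp only [expMidpointStep, expTaylorTwo, Finset.sum_range_succ, Finset.sum_range_zero,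
    Nat.factorial_zero, Nat.factorial_one, Nat.factorial_two, Nat.cast_one, Nat.cast_ofNat,
    Pi.one_apply, Pi.zero_apply, smul_pow, pow_zero, pow_one, pow_two, mul_add, add_mul, mul_one,
    one_mul]
  module

variable {F : Type*} [NormedAddCommGroup F] [NormedSpace ℝ F] [CompleteSpace F]

theorem exists_norm_flow_sub_expMidpointStep_le {A J : ℝ → F →L[ℝ] F} {T : ℝ} (hT : 0 < T)
    (hA : ContDiffOn ℝ 2 A (Icc 0 T)) (hJ : ContDiffOn ℝ 2 J (Icc 0 T)) (M : ℝ) :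
    ∃ C, ∀ (t τ : ℝ) (ρ : ℝ → F), 0 ≤ t → 0 ≤ τ → t + τ ≤ T →
      (∀ u ∈ Icc t (t + τ), HasDerivWithinAt ρ ((A u + J u) (ρ u)) (Icc t (t + τ)) u) →
      ‖ρ t‖ ≤ M →
      ‖ρ (t + τ) - expMidpointStep (A (t + τ / 2)) (J (t + τ / 2)) (A t) (J t) τ (ρ t)‖ ≤
        C * τ ^ 3 := by
  obtain ⟨C₁, hC₁⟩ := exists_norm_flow_sub_midpoint_le hT (hA.add hJ) M
  set steps : Set (ℝ × ℝ) := {p | 0 ≤ p.1 ∧ 0 ≤ p.2 ∧ p.1 + p.2 ≤ T}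
  have left_mem : ∀ p ∈ steps, p.1 ∈ Icc 0 T := fun p ⟨h₁, h₂, h₃⟩ => ⟨h₁, by linarith⟩
  have mid_mem : ∀ p ∈ steps, p.1 + p.2 / 2 ∈ Icc 0 T := fun p ⟨h₁, h₂, h₃⟩ =>
    ⟨by linarith, by linarith⟩
  have bounded : ∀ {f f' : ℝ → F →L[ℝ] F} {K : ℝ}, HasTaylorBound f f' (Icc 0 T) K →
      (fun p : ℝ × ℝ => f (p.1 + p.2 / 2)) =O[𝓟 steps] fun _ => (1 : ℝ) := fun {f f' K} h =>
    isBigO_principal.2 ⟨K, fun p hp => by simpa using h.norm_le _ (mid_mem p hp)⟩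
  have lipschitz : ∀ {f f' : ℝ → F →L[ℝ] F} {K : ℝ}, HasTaylorBound f f' (Icc 0 T) K →
      (fun p : ℝ × ℝ => f p.1 - f (p.1 + p.2 / 2)) =O[𝓟 steps] fun p => p.2 := fun {f f' K} h =>
    isBigO_principal.2 ⟨K, fun p hp => by
      have hp₂ := hp.2.1
      rw [norm_sub_rev, Real.norm_of_nonneg hp₂]
      refine (h.norm_sub_le _ (left_mem p hp) _ (mid_mem p hp) (by linarith)).trans ?_
      exact mul_le_mul_of_nonneg_left (by linarith) h.nonneg⟩
  have step_bounded : (fun p : ℝ × ℝ => p.2) =O[𝓟 steps] fun _ => (1 : ℝ) :=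
    isBigO_principal.2 ⟨T, fun p ⟨h₁, h₂, h₃⟩ => by
      rw [Real.norm_of_nonneg h₂, norm_one]
      linarith⟩
  obtain ⟨KA, hKA⟩ := exists_hasTaylorBound hT hA
  obtain ⟨KJ, hKJ⟩ := exists_hasTaylorBound hT hJ
  obtain ⟨C₂, hC₂⟩ := isBigO_principal.1 (isBigO_expMidpointStep_sub step_bounded (bounded hKA)
    (bounded hKJ) (lipschitz hKA) (lipschitz hKJ))
  refine ⟨C₁ + C₂ * M, fun t τ ρ ht hτ htT hρ hM => ?_⟩
  have flow_error := hC₁ t τ ρ ht hτ htT hρ hM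
  have scheme_error := hC₂ (t, τ) ⟨ht, hτ, htT⟩
  rw [norm_sub_rev, Real.norm_of_nonneg (pow_nonneg hτ 3)] at scheme_error
  have := norm_add_le_of_le flow_error (ContinuousLinearMap.le_of_opNorm_le_of_le _ scheme_error hM)
  rw [_root_.sub_apply, sub_add_sub_cancel] at this
  exact this.trans_eq (by ring)

end Scheme

open Matrix
open scoped Matrix.Norms.L2Operator

section TraceNorm

section Spectral

variable {𝕜 n : Type*} [RCLike 𝕜] [Fintype n] [DecidableEq n]

theorem trace_eq_sum_inner (X : Matrix n n 𝕜) (b : OrthonormalBasis n 𝕜 (EuclideanSpace 𝕜 n)) :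
    X.trace = ∑ j, inner 𝕜 (b j) (toEuclideanCLM (𝕜 := 𝕜) X (b j)) := by
  rw [← Matrix.trace_toLin_eq X (PiLp.basisFun 2 𝕜 n), LinearMap.trace_eq_sum_inner _ b]
  rfl

theorem toEuclideanCLM_eigenvectorBasis {X : Matrix n n 𝕜} (hX : X.IsHermitian) (j : n) :
    toEuclideanCLM (𝕜 := 𝕜) X (hX.eigenvectorBasis j) =
      (hX.eigenvalues j : 𝕜) • hX.eigenvectorBasis j := by
  ext i
  simpa [RCLike.real_smul_eq_coe_mul] using congrFun (hX.mulVec_eigenvectorBasis j) i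

theorem trace_cfc {X : Matrix n n 𝕜} (hX : X.IsHermitian) (f : ℝ → ℝ) :
    (cfc f X).trace = ∑ j, (f (hX.eigenvalues j) : 𝕜) := by
  rw [hX.cfc_eq, IsHermitian.cfc, Unitary.conjStarAlgAut_apply, trace_mul_comm, ← mul_assoc,
    Unitary.coe_star_mul_self, one_mul, trace_diagonal]
  rfl

theorem norm_toEuclideanCLM_eigenvectorBasis (X : Matrix n n 𝕜) (j : n) :
    ‖toEuclideanCLM (𝕜 := 𝕜) X ((isHermitian_conjTranspose_mul_self X).eigenvectorBasis j)‖ =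
      √((isHermitian_conjTranspose_mul_self X).eigenvalues j) := by
  set hX := isHermitian_conjTranspose_mul_self X
  have norm_sq := ContinuousLinearMap.apply_norm_sq_eq_inner_adjoint_right
    (toEuclideanCLM (𝕜 := 𝕜) X) (hX.eigenvectorBasis j)
  rw [← ContinuousLinearMap.star_eq_adjoint, ← ContinuousLinearMap.mul_def, ← map_star, ← map_mul,
    star_eq_conjTranspose, toEuclideanCLM_eigenvectorBasis hX, inner_smul_right,
    inner_self_eq_norm_sq_to_K, hX.eigenvectorBasis.orthonormal.1 j] at norm_sq
  rw [← Real.sqrt_sq (norm_nonneg _), norm_sq]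
  simp

theorem norm_inner_toEuclideanCLM_le (W : Matrix n n 𝕜) (v w : EuclideanSpace 𝕜 n) :
    ‖inner 𝕜 v (toEuclideanCLM (𝕜 := 𝕜) W w)‖ ≤ ‖v‖ * (‖W‖ * ‖w‖) := by
  refine (norm_inner_le_norm _ _).trans ?_
  rw [← l2_opNorm_toEuclideanCLM]
  exact mul_le_mul_of_nonneg_left (ContinuousLinearMap.le_opNorm _ _) (norm_nonneg _)

end Spectral

variable {m : ℕ}

theorem traceNorm_nonneg (X : Matrix (Fin m) (Fin m) ℂ) : 0 ≤ traceNorm X :=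
  Finset.sum_nonneg fun _ _ => Real.sqrt_nonneg _

theorem norm_trace_mul_le (W X : Matrix (Fin m) (Fin m) ℂ) :
    ‖(W * X).trace‖ ≤ ‖W‖ * traceNorm X := by
  set b := (isHermitian_conjTranspose_mul_self X).eigenvectorBasis
  rw [trace_eq_sum_inner (W * X) b, traceNorm, Finset.mul_sum]
  refine (norm_sum_le _ _).trans (Finset.sum_le_sum fun j _ => ?_)
  rw [map_mul, mul_apply_eq_comp, ← norm_toEuclideanCLM_eigenvectorBasis]
  simpa [b.orthonormal.1 j] using norm_inner_toEuclideanCLM_le W (b j) _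

/-- The maximiser is the adjoint `(X†X)^{-1/2} X†` of the polar factor of `X`; since
`Real.sqrt 0 = 0` and `0⁻¹ = 0`, the functional calculus of `(√x)⁻¹` vanishes on the kernel. -/
theorem exists_trace_mul_eq_traceNorm (X : Matrix (Fin m) (Fin m) ℂ) :
    ∃ W : Matrix (Fin m) (Fin m) ℂ, ‖W‖ ≤ 1 ∧ (W * X).trace = traceNorm X := by
  have hX := isHermitian_conjTranspose_mul_self X
  set P := Xᴴ * X with hP
  have hP_selfAdjoint : IsSelfAdjoint P := hX
  have cfc_mul_self : ∀ f : ℝ → ℝ, cfc f P * P = cfc (fun x => f x * x) P := fun f => by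
    rw [cfc_mul f (fun x => x) P (P.finite_real_spectrum.continuousOn f)
      (P.finite_real_spectrum.continuousOn _), cfc_id' ℝ P]
  set S := cfc (fun x : ℝ => (√x)⁻¹) P with hS
  have inv_sqrt_mul : ∀ x : ℝ, (√x)⁻¹ * x = √x := fun x => by
    rw [mul_comm, ← div_eq_mul_inv, Real.div_sqrt]
  have S_mul : S * P = cfc Real.sqrt P := by
    rw [hS, cfc_mul_self]
    simp only [inv_sqrt_mul]
  refine ⟨S * Xᴴ, ?_, ?_⟩
  · have self_mul_star : (S * Xᴴ) * star (S * Xᴴ) = cfc (fun x : ℝ => √x * (√x)⁻¹) P := by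
      calc (S * Xᴴ) * star (S * Xᴴ) = S * P * star S := by
            simp only [star_mul, star_eq_conjTranspose, conjTranspose_conjTranspose, hP, mul_assoc]
        _ = cfc Real.sqrt P * S := by
            rw [S_mul, IsSelfAdjoint.star_eq (cfc_predicate _ P)]
        _ = cfc (fun x : ℝ => √x * (√x)⁻¹) P :=
            (cfc_mul _ _ P (P.finite_real_spectrum.continuousOn _)
              (P.finite_real_spectrum.continuousOn _)).symm
    have norm_sq_le : ‖S * Xᴴ‖ * ‖S * Xᴴ‖ ≤ 1 := by
      rw [← CStarRing.norm_self_mul_star, self_mul_star]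
      refine norm_cfc_le zero_le_one fun x _ => ?_
      rw [Real.norm_of_nonneg (by positivity)]
      exact mul_inv_le_one
    exact (le_abs_self _).trans (abs_le_one_iff_mul_self_le_one.2 norm_sq_le)
  · rw [mul_assoc, ← hP, S_mul, trace_cfc hX, traceNorm, Complex.ofReal_sum]
    rfl

theorem traceNorm_le_of_forall {X : Matrix (Fin m) (Fin m) ℂ} {c : ℝ}
    (h : ∀ W : Matrix (Fin m) (Fin m) ℂ, ‖W‖ ≤ 1 → ‖(W * X).trace‖ ≤ c) : traceNorm X ≤ c := by
  obtain ⟨W, hW, hWX⟩ := exists_trace_mul_eq_traceNorm X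
  have := h W hW
  rwa [hWX, Complex.norm_of_nonneg (traceNorm_nonneg X)] at this

theorem norm_trace_mul_le_of_norm_le_one {W : Matrix (Fin m) (Fin m) ℂ} (hW : ‖W‖ ≤ 1)
    (X : Matrix (Fin m) (Fin m) ℂ) : ‖(W * X).trace‖ ≤ traceNorm X :=
  (norm_trace_mul_le W X).trans (mul_le_of_le_one_left (traceNorm_nonneg X) hW)

theorem norm_trace_le (X : Matrix (Fin m) (Fin m) ℂ) : ‖X.trace‖ ≤ traceNorm X := by
  have norm_one_le : ‖(1 : Matrix (Fin m) (Fin m) ℂ)‖ ≤ 1 := by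
    rw [← l2_opNorm_toEuclideanCLM, map_one]
    exact ContinuousLinearMap.norm_id_le
  simpa using norm_trace_mul_le_of_norm_le_one norm_one_le X

theorem traceNorm_zero : traceNorm (0 : Matrix (Fin m) (Fin m) ℂ) = 0 :=
  le_antisymm (traceNorm_le_of_forall fun W _ => by simp) (traceNorm_nonneg _)

theorem traceNorm_add_le (X Y : Matrix (Fin m) (Fin m) ℂ) :
    traceNorm (X + Y) ≤ traceNorm X + traceNorm Y :=
  traceNorm_le_of_forall fun W hW => by
    rw [mul_add, trace_add]
    exact norm_add_le_of_le (norm_trace_mul_le_of_norm_le_one hW X)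
      (norm_trace_mul_le_of_norm_le_one hW Y)

theorem traceNorm_sum_le {ι : Type*} (s : Finset ι) (X : ι → Matrix (Fin m) (Fin m) ℂ) :
    traceNorm (∑ i ∈ s, X i) ≤ ∑ i ∈ s, traceNorm (X i) :=
  Finset.le_sum_of_subadditive traceNorm traceNorm_zero.le traceNorm_add_le s X

theorem traceNorm_smul_le {𝕜 : Type*} [NormedField 𝕜] [NormedAlgebra 𝕜 ℂ] (c : 𝕜)
    (X : Matrix (Fin m) (Fin m) ℂ) : traceNorm (c • X) ≤ ‖c‖ * traceNorm X :=
  traceNorm_le_of_forall fun W hW => by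
    rw [mul_smul_comm, trace_smul, norm_smul]
    exact mul_le_mul_of_nonneg_left (norm_trace_mul_le_of_norm_le_one hW X) (norm_nonneg _)

theorem traceNorm_mul_mul_le (U X V : Matrix (Fin m) (Fin m) ℂ) :
    traceNorm (U * X * V) ≤ ‖U‖ * ‖V‖ * traceNorm X :=
  traceNorm_le_of_forall fun W hW => by
    have cyclic : (W * (U * X * V)).trace = (V * W * U * X).trace := by
      rw [← mul_assoc, trace_mul_comm]
      simp only [mul_assoc]
    have norm_le : ‖V * W * U‖ ≤ ‖U‖ * ‖V‖ := calc
      ‖V * W * U‖ ≤ ‖V‖ * ‖W‖ * ‖U‖ := norm_mul₃_le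
      _ ≤ ‖V‖ * 1 * ‖U‖ := by gcongr
      _ = ‖U‖ * ‖V‖ := by ring
    rw [cyclic]
    exact (norm_trace_mul_le _ X).trans (mul_le_mul_of_nonneg_right norm_le (traceNorm_nonneg X))

theorem l2_opNorm_le_traceNorm (X : Matrix (Fin m) (Fin m) ℂ) : ‖X‖ ≤ traceNorm X := by
  set b := (isHermitian_conjTranspose_mul_self X).eigenvectorBasis
  rw [← l2_opNorm_toEuclideanCLM]
  refine ContinuousLinearMap.opNorm_le_bound _ (traceNorm_nonneg X) fun v => ?_
  conv_lhs => rw [← b.sum_repr' v, map_sum]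
  rw [traceNorm, Finset.sum_mul]
  refine (norm_sum_le _ _).trans (Finset.sum_le_sum fun j _ => ?_)
  rw [map_smul, norm_smul, ← norm_toEuclideanCLM_eigenvectorBasis, mul_comm]
  refine mul_le_mul_of_nonneg_left ?_ (norm_nonneg _)
  simpa [b.orthonormal.1 j] using norm_inner_le_norm (𝕜 := ℂ) (b j) v

theorem traceNorm_le_mul_l2_opNorm (X : Matrix (Fin m) (Fin m) ℂ) : traceNorm X ≤ m * ‖X‖ := by
  set b := (isHermitian_conjTranspose_mul_self X).eigenvectorBasis
  calc traceNorm X ≤ ∑ _j : Fin m, ‖X‖ := Finset.sum_le_sum fun j _ => by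
        rw [← norm_toEuclideanCLM_eigenvectorBasis, ← l2_opNorm_toEuclideanCLM X]
        simpa [b.orthonormal.1 j] using (toEuclideanCLM (𝕜 := ℂ) X).le_opNorm (b j)
    _ = m * ‖X‖ := by simp

theorem traceNorm_le_norm_trace {X : Matrix (Fin m) (Fin m) ℂ} (hX : X.PosSemidef) :
    traceNorm X ≤ ‖X.trace‖ := by
  set b := hX.isHermitian.eigenvectorBasis
  have eigenvalues_nonneg := hX.eigenvalues_nonneg
  have norm_trace : ‖X.trace‖ = ∑ j, hX.isHermitian.eigenvalues j := by
    rw [hX.isHermitian.trace_eq_sum_eigenvalues]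
    norm_cast
    exact Real.norm_of_nonneg (Finset.sum_nonneg fun j _ => eigenvalues_nonneg j)
  refine traceNorm_le_of_forall fun W hW => ?_
  rw [norm_trace, trace_eq_sum_inner (W * X) b]
  refine (norm_sum_le _ _).trans (Finset.sum_le_sum fun j _ => ?_)
  rw [map_mul, mul_apply_eq_comp, toEuclideanCLM_eigenvectorBasis, map_smul, inner_smul_right,
    norm_mul, RCLike.norm_ofReal, abs_of_nonneg (eigenvalues_nonneg j)]
  have inner_le := norm_inner_toEuclideanCLM_le W (b j) (b j)
  rw [b.orthonormal.1 j, one_mul, mul_one] at inner_le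
  exact mul_le_of_le_one_right (eigenvalues_nonneg j) (inner_le.trans hW)

theorem IsDensity.traceNorm_le {X : Matrix (Fin m) (Fin m) ℂ} (hX : IsDensity X) :
    traceNorm X ≤ 1 := by
  simpa [hX.2] using traceNorm_le_norm_trace hX.1

end TraceNorm

section Sylvester

open NormedSpace (exp)

variable {E : Type*} [NormedRing E] [NormedAlgebra ℝ E]

/-- The Sylvester operator `x ↦ a x + x b`. -/
noncomputable def sylvester (a b : E) : E →L[ℝ] E :=
  ContinuousLinearMap.mul ℝ E a + (ContinuousLinearMap.mul ℝ E).flip b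

theorem sylvester_apply (a b x : E) : sylvester a b x = a * x + x * b := rfl

theorem smul_sylvester (c : ℝ) (a b : E) : c • sylvester a b = sylvester (c • a) (c • b) := by
  simp only [sylvester, map_smul, smul_add]

variable [CompleteSpace E]

theorem exp_mul_left (a : E) :
    exp (ContinuousLinearMap.mul ℝ E a) = ContinuousLinearMap.mul ℝ E (exp a) := by
  let leftMul : E →+* (E →L[ℝ] E) :=
    { toFun := ContinuousLinearMap.mul ℝ E
      map_one' := by ext; simp
      map_mul' := fun a b => by ext; simp [mul_assoc]
      map_zero' := map_zero _
      map_add' := map_add _ }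
  let _ := NormedAlgebra.restrictScalars ℚ ℝ E
  exact (NormedSpace.map_exp leftMul (ContinuousLinearMap.mul ℝ E).continuous a).symm

theorem exp_mul_right (b : E) :
    exp ((ContinuousLinearMap.mul ℝ E).flip b) = (ContinuousLinearMap.mul ℝ E).flip (exp b) := by
  let rightMul : Eᵐᵒᵖ →+* (E →L[ℝ] E) :=
    { toFun := fun b => (ContinuousLinearMap.mul ℝ E).flip b.unop
      map_one' := by ext; simp
      map_mul' := fun a b => by ext; simp [mul_assoc]
      map_zero' := map_zero _
      map_add' := fun a b => map_add _ a.unop b.unop }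
  let _ := NormedAlgebra.restrictScalars ℚ ℝ E
  have := NormedSpace.map_exp rightMul
    ((ContinuousLinearMap.mul ℝ E).flip.continuous.comp MulOpposite.continuous_unop)
    (MulOpposite.op b)
  rw [NormedSpace.exp_op] at this
  exact this.symm

theorem exp_sylvester_apply (a b x : E) : exp (sylvester a b) x = exp a * x * exp b := by
  have commute : Commute (ContinuousLinearMap.mul ℝ E a) ((ContinuousLinearMap.mul ℝ E).flip b) :=
    ContinuousLinearMap.ext fun x => (mul_assoc a x b).symm
  let _ := NormedAlgebra.restrictScalars ℚ ℝ (E →L[ℝ] E)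
  rw [sylvester, NormedSpace.exp_add_of_commute commute, exp_mul_left, exp_mul_right,
    mul_apply_eq_comp, ContinuousLinearMap.mul_apply', ContinuousLinearMap.flip_apply,
    ContinuousLinearMap.mul_apply', mul_assoc]

end Sylvester

section Contraction

open NormedSpace (exp)

theorem norm_exp_smul_le_one {V : Type*} [NormedAddCommGroup V] [InnerProductSpace ℂ V]
    [CompleteSpace V] {A : V →L[ℂ] V} (hA : ∀ x, (inner ℂ x (A x)).re ≤ 0) {t : ℝ} (ht : 0 ≤ t) :
    ‖exp (t • A)‖ ≤ 1 := by
  refine ContinuousLinearMap.opNorm_le_bound _ zero_le_one fun x => ?_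
  let _ := InnerProductSpace.complexToReal (G := V)
  have deriv_orbit : ∀ s : ℝ,
      HasDerivAt (fun s : ℝ => exp (s • A) x) (A (exp (s • A) x)) s := fun s =>
    ((ContinuousLinearMap.apply ℂ V x).restrictScalars ℝ).hasFDerivAt.comp_hasDerivAt s
      (hasDerivAt_exp_smul_const' (𝕂 := ℝ) A s)
  have antitone_norm_sq : Antitone fun s : ℝ => ‖exp (s • A) x‖ ^ 2 := by
    refine antitone_of_hasDerivAt_nonpos (fun s => (deriv_orbit s).norm_sq) fun s => ?_
    rw [real_inner_eq_re_inner ℂ]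
    exact mul_nonpos_of_nonneg_of_nonpos zero_le_two (hA _)
  have norm_sq_le := antitone_norm_sq ht
  simp only [zero_smul, NormedSpace.exp_zero, one_apply_eq_self] at norm_sq_le
  rw [one_mul]
  exact (sq_le_sq₀ (norm_nonneg _) (norm_nonneg _)).1 norm_sq_le

variable {n : Type*} [Fintype n] [DecidableEq n]

theorem re_inner_toEuclideanCLM_nonpos {B : Matrix n n ℂ} (hB : (-(B + Bᴴ)).PosSemidef)
    (x : EuclideanSpace ℂ n) : (inner ℂ x (toEuclideanCLM (𝕜 := ℂ) B x)).re ≤ 0 := by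
  have nonneg := (isPositive_toEuclideanLin_iff.2 hB).re_inner_nonneg_right x
  have expand : inner ℂ x (toEuclideanLin (-(B + Bᴴ)) x) =
      -(inner ℂ x (toEuclideanCLM (𝕜 := ℂ) B x) +
        inner ℂ (toEuclideanCLM (𝕜 := ℂ) B x) x) := by
    rw [← ContinuousLinearMap.adjoint_inner_right, ← ContinuousLinearMap.star_eq_adjoint,
      ← map_star, ← inner_add_right, ← inner_neg_right, ← _root_.add_apply, ← map_add,
      ← _root_.neg_apply, ← map_neg]
    rfl
  rw [expand, map_neg, map_add, inner_re_symm (toEuclideanCLM (𝕜 := ℂ) B x)] at nonneg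
  change 0 ≤ -((inner ℂ x (toEuclideanCLM (𝕜 := ℂ) B x)).re +
    (inner ℂ x (toEuclideanCLM (𝕜 := ℂ) B x)).re) at nonneg
  linarith

theorem l2_opNorm_exp_smul_le_one {B : Matrix n n ℂ} (hB : (-(B + Bᴴ)).PosSemidef) {t : ℝ}
    (ht : 0 ≤ t) : ‖exp (t • B)‖ ≤ 1 := by
  let _ := NormedAlgebra.restrictScalars ℚ ℝ (Matrix n n ℂ)
  have continuous : Continuous (toEuclideanCLM (n := n) (𝕜 := ℂ)) :=
    (toEuclideanCLM (n := n) (𝕜 := ℂ)).toAlgEquiv.toLinearMap.continuous_of_finiteDimensional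
  have map_exp : toEuclideanCLM (𝕜 := ℂ) (exp (t • B)) = exp (t • toEuclideanCLM (𝕜 := ℂ) B) := by
    rw [NormedSpace.map_exp _ continuous, ← Complex.coe_smul, map_smul]
    rfl
  rw [← l2_opNorm_toEuclideanCLM, map_exp]
  exact norm_exp_smul_le_one (re_inner_toEuclideanCLM_nonpos hB) ht

end Contraction

section Entries

variable {m : ℕ}

theorem contDiffOn_of_entries {f : ℝ → Matrix (Fin m) (Fin m) ℂ} {s : Set ℝ} {k : WithTop ℕ∞}
    (h : ∀ i j, ContDiffOn ℝ k (fun t => f t i j) s) : ContDiffOn ℝ k f s := by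
  let ofEntries : (Fin m → Fin m → ℂ) →L[ℝ] Matrix (Fin m) (Fin m) ℂ :=
    LinearMap.toContinuousLinearMap (ofLinearEquiv ℝ).toLinearMap
  exact ofEntries.contDiff.comp_contDiffOn (f := fun t i j => f t i j)
    (contDiffOn_pi.2 fun i => contDiffOn_pi.2 (h i))

theorem hasDerivWithinAt_of_entries {f : ℝ → Matrix (Fin m) (Fin m) ℂ}
    {f' : Matrix (Fin m) (Fin m) ℂ} {s : Set ℝ} {t : ℝ}
    (h : ∀ i j, HasDerivWithinAt (fun t => f t i j) (f' i j) s t) : HasDerivWithinAt f f' s t := by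
  let ofEntries : (Fin m → Fin m → ℂ) →L[ℝ] Matrix (Fin m) (Fin m) ℂ :=
    LinearMap.toContinuousLinearMap (ofLinearEquiv ℝ).toLinearMap
  exact ofEntries.hasFDerivAt.comp_hasDerivWithinAt (f := fun t i j => f t i j) t
    (hasDerivWithinAt_pi.2 fun i => hasDerivWithinAt_pi.2 (h i))

theorem isClosed_setOf_posSemidef : IsClosed {X : Matrix (Fin m) (Fin m) ℂ | X.PosSemidef} := by
  open scoped MatrixOrder in
  convert isClosed_Ici (a := (0 : Matrix (Fin m) (Fin m) ℂ)) using 1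
  exact Set.ext fun X => nonneg_iff_posSemidef.symm

end Entries

section Stability

open NormedSpace (exp)

variable {F : Type*} [NormedAddCommGroup F] [NormedSpace ℝ F]

theorem seminorm_expMidpointStep_le (p : Seminorm ℝ F) {A J A₁ J₁ : F →L[ℝ] F} {c τ : ℝ}
    (hc : 0 ≤ c) (hτ : 0 ≤ τ) (hA : ∀ σ : ℝ, 0 ≤ σ → ∀ x, p (exp (σ • A) x) ≤ p x)
    (hJ : ∀ x, p (J x) ≤ c * p x) (hA₁ : ∀ σ : ℝ, 0 ≤ σ → ∀ x, p (exp (σ • A₁) x) ≤ p x)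
    (hJ₁ : ∀ x, p (J₁ x) ≤ c * p x) (x : F) :
    p (expMidpointStep A J A₁ J₁ τ x) ≤ Real.exp (c * τ) * p x := by
  have half_nonneg : 0 ≤ τ / 2 := by positivity
  set y := exp ((τ / 2) • A₁) (x + (τ / 2) • J₁ x)
  have half_step : p y ≤ (1 + τ / 2 * c) * p x :=
    calc p y ≤ p (x + (τ / 2) • J₁ x) := hA₁ _ half_nonneg _
      _ ≤ p x + τ / 2 * p (J₁ x) := by
        grw [map_add_le_add, map_smul_eq_mul, Real.norm_of_nonneg half_nonneg]
      _ ≤ p x + τ / 2 * (c * p x) := by gcongr; exact hJ₁ x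
      _ = (1 + τ / 2 * c) * p x := by ring
  calc p (exp (τ • A) x + τ • exp ((τ / 2) • A) (J y))
      ≤ p (exp (τ • A) x) + τ * p (exp ((τ / 2) • A) (J y)) := by
        grw [map_add_le_add, map_smul_eq_mul, Real.norm_of_nonneg hτ]
    _ ≤ p x + τ * (c * ((1 + τ / 2 * c) * p x)) := by
        grw [hA τ hτ, hA (τ / 2) half_nonneg, hJ, half_step]
    _ = (1 + c * τ + (c * τ) ^ 2 / 2) * p x := by ring
    _ ≤ Real.exp (c * τ) * p x := by
        gcongr
        exact Real.quadratic_le_exp_of_nonneg (mul_nonneg hc hτ)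

end Stability

section Step

open NormedSpace (exp)

variable {m K : ℕ} {H : ℝ → Matrix (Fin m) (Fin m) ℂ} {L : Fin K → Matrix (Fin m) (Fin m) ℂ}
  {γ : Fin K → ℝ → ℝ} {T t τ : ℝ} {X : Matrix (Fin m) (Fin m) ℂ}

variable (H L γ t) in
/-- The no-jump part `X ↦ A(t) X + X A(t)†` of the Lindblad generator. -/
noncomputable def drift : Matrix (Fin m) (Fin m) ℂ →L[ℝ] Matrix (Fin m) (Fin m) ℂ :=
  sylvester (generator H L γ t) (generator H L γ t)ᴴ

variable (L γ t) in
/-- The jump part `X ↦ ∑ₖ γₖ(t) Lₖ X Lₖ†` of the Lindblad generator. -/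
noncomputable def jump : Matrix (Fin m) (Fin m) ℂ →L[ℝ] Matrix (Fin m) (Fin m) ℂ :=
  ∑ k, γ k t • ContinuousLinearMap.mulLeftRight ℝ _ (L k) (L k)ᴴ

theorem jump_apply (X : Matrix (Fin m) (Fin m) ℂ) :
    jump L γ t X = ∑ k, γ k t • (L k * X * (L k)ᴴ) := by
  simp [jump]

theorem generator_conjTranspose (hH : (H t).IsHermitian) : (generator H L γ t)ᴴ =
    Complex.I • H t - (1 / 2 : ℂ) • ∑ k, (γ k t : ℂ) • ((L k)ᴴ * L k) := by
  simp [generator, conjTranspose_sub, conjTranspose_sum, conjTranspose_smul, hH.eq]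

theorem lindbladRHS_eq (hH : (H t).IsHermitian) (X : Matrix (Fin m) (Fin m) ℂ) :
    lindbladRHS H L γ t X = (drift H L γ t + jump L γ t) X := by
  rw [_root_.add_apply, drift, sylvester_apply, generator_conjTranspose hH, lindbladRHS, generator,
    jump_apply]
  simp only [← Complex.coe_smul, smul_sub, smul_add, Finset.sum_sub_distrib,
    Finset.sum_add_distrib, sub_mul, mul_sub, Finset.smul_sum, Finset.sum_mul, Finset.mul_sum,
    smul_mul_assoc, mul_smul_comm, smul_comm (1 / 2 : ℂ)]
  module

theorem neg_generator_add_posSemidef (hH : (H t).IsHermitian) (hγ : ∀ k, 0 ≤ γ k t) :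
    (-(generator H L γ t + (generator H L γ t)ᴴ)).PosSemidef := by
  have eq_sum : -(generator H L γ t + (generator H L γ t)ᴴ) =
      ∑ k, (γ k t : ℂ) • ((L k)ᴴ * L k) := by
    rw [generator_conjTranspose hH, generator]
    module
  rw [eq_sum]
  exact posSemidef_sum _ fun k _ =>
    (posSemidef_conjTranspose_mul_self (L k)).smul (Complex.zero_le_real.2 (hγ k))

theorem exp_smul_drift_apply (τ : ℝ) (X : Matrix (Fin m) (Fin m) ℂ) :
    exp (τ • drift H L γ t) X =
      exp (τ • generator H L γ t) * X * exp (τ • (generator H L γ t)ᴴ) := by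
  rw [drift, smul_sylvester, exp_sylvester_apply]

theorem exp_smul_drift_apply_eq_conj (τ : ℝ) (X : Matrix (Fin m) (Fin m) ℂ) :
    exp (τ • drift H L γ t) X =
      exp (τ • generator H L γ t) * X * (exp (τ • generator H L γ t))ᴴ := by
  rw [exp_smul_drift_apply, ← exp_conjTranspose, conjTranspose_smul, star_trivial]

theorem fremStep_eq_expMidpointStep (τ t : ℝ) (X : Matrix (Fin m) (Fin m) ℂ) :
    fremStep H L γ τ t X = expMidpointStep (drift H L γ (t + τ / 2)) (jump L γ (t + τ / 2))
      (drift H L γ t) (jump L γ t) τ X := by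
  have half_eq : fremHalf H L γ τ t X =
      exp ((τ / 2) • drift H L γ t) (X + (τ / 2) • jump L γ t X) := by
    simp only [fremHalf, exp_smul_drift_apply, jump_apply, Complex.coe_smul]
  change _ = exp (τ • drift H L γ (t + τ / 2)) X + τ • exp ((τ / 2) • drift H L γ (t + τ / 2))
    (jump L γ (t + τ / 2) (exp ((τ / 2) • drift H L γ t) (X + (τ / 2) • jump L γ t X)))
  simp only [fremStep, half_eq, exp_smul_drift_apply, jump_apply, Complex.coe_smul,
    Finset.mul_sum, Finset.sum_mul, mul_smul_comm, smul_mul_assoc]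

theorem fremStep_sub (τ t : ℝ) (X Y : Matrix (Fin m) (Fin m) ℂ) :
    fremStep H L γ τ t (X - Y) = fremStep H L γ τ t X - fremStep H L γ τ t Y := by
  simp only [fremStep_eq_expMidpointStep, map_sub]

theorem fremStep_smul (τ t : ℝ) (c : ℂ) (X : Matrix (Fin m) (Fin m) ℂ) :
    fremStep H L γ τ t (c • X) = c • fremStep H L γ τ t X := by
  simp only [fremStep, fremHalf, smul_add, Finset.smul_sum, Finset.mul_sum, Finset.sum_mul, mul_add,
    add_mul, mul_smul_comm, smul_mul_assoc, smul_comm c]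

theorem exp_smul_drift_posSemidef (τ : ℝ) (hX : X.PosSemidef) :
    (exp (τ • drift H L γ t) X).PosSemidef := by
  rw [exp_smul_drift_apply_eq_conj]
  exact hX.mul_mul_conjTranspose_same _

theorem exp_smul_drift_apply_ne_zero (τ : ℝ) (hX : X ≠ 0) : exp (τ • drift H L γ t) X ≠ 0 := by
  let _ := NormedAlgebra.restrictScalars ℚ ℝ
    (Matrix (Fin m) (Fin m) ℂ →L[ℝ] Matrix (Fin m) (Fin m) ℂ)
  obtain ⟨S, hS⟩ := (NormedSpace.isUnit_exp (τ • drift H L γ t)).exists_left_inv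
  intro exp_eq
  have : S (exp (τ • drift H L γ t) X) = X := DFunLike.congr_fun hS X
  rw [exp_eq, map_zero] at this
  exact hX this.symm

theorem jump_posSemidef (hγ : ∀ k, 0 ≤ γ k t) (hX : X.PosSemidef) :
    (jump L γ t X).PosSemidef := by
  rw [jump_apply]
  exact posSemidef_sum _ fun k _ => (hX.mul_mul_conjTranspose_same (L k)).smul (hγ k)

theorem fremStep_sub_exp_smul_drift_posSemidef (hτ : 0 ≤ τ) (hγ : ∀ k, 0 ≤ γ k t)
    (hγ_mid : ∀ k, 0 ≤ γ k (t + τ / 2)) (hX : X.PosSemidef) :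
    (fremStep H L γ τ t X - exp (τ • drift H L γ (t + τ / 2)) X).PosSemidef := by
  rw [fremStep_eq_expMidpointStep, expMidpointStep, _root_.add_apply, add_sub_cancel_left]
  refine PosSemidef.smul (exp_smul_drift_posSemidef _ (jump_posSemidef hγ_mid
    (exp_smul_drift_posSemidef _ (hX.add ?_)))) hτ
  exact PosSemidef.smul (jump_posSemidef hγ hX) (by positivity : 0 ≤ τ / 2)

theorem fremStep_posSemidef (hτ : 0 ≤ τ) (hγ : ∀ k, 0 ≤ γ k t)
    (hγ_mid : ∀ k, 0 ≤ γ k (t + τ / 2)) (hX : X.PosSemidef) :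
    (fremStep H L γ τ t X).PosSemidef := by
  simpa only [sub_add_cancel] using
    (fremStep_sub_exp_smul_drift_posSemidef (H := H) (L := L) hτ hγ hγ_mid hX).add
      (exp_smul_drift_posSemidef (H := H) (L := L) (γ := γ) (t := t + τ / 2) τ hX)

open scoped MatrixOrder in
theorem fremStep_ne_zero (hτ : 0 ≤ τ) (hγ : ∀ k, 0 ≤ γ k t)
    (hγ_mid : ∀ k, 0 ≤ γ k (t + τ / 2)) (hX : X.PosSemidef) (hX₀ : X ≠ 0) :
    fremStep H L γ τ t X ≠ 0 := fun step_eq => by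
  have exp_le : exp (τ • drift H L γ (t + τ / 2)) X ≤ fremStep H L γ τ t X :=
    sub_nonneg.1 (fremStep_sub_exp_smul_drift_posSemidef hτ hγ hγ_mid hX).nonneg
  have exp_eq : exp (τ • drift H L γ (t + τ / 2)) X = 0 :=
    le_antisymm (step_eq ▸ exp_le) (exp_smul_drift_posSemidef τ hX).nonneg
  exact exp_smul_drift_apply_ne_zero τ hX₀ exp_eq

theorem stabilityConst_nonneg (hγ : ∀ k, ∀ t ∈ Icc 0 T, 0 ≤ γ k t) : 0 ≤ stabilityConst L γ T :=
  Finset.sum_nonneg fun k _ =>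
    mul_nonneg (Real.sSup_nonneg (forall_mem_image.2 (hγ k))) (sq_nonneg _)

theorem traceNorm_conj_le (U X : Matrix (Fin m) (Fin m) ℂ) :
    traceNorm (U * X * Uᴴ) ≤ ‖U‖ ^ 2 * traceNorm X := by
  simpa only [l2_opNorm_conjTranspose, sq] using traceNorm_mul_mul_le U X Uᴴ

theorem traceNorm_exp_smul_drift_le (hH : (H t).IsHermitian) (hγ : ∀ k, 0 ≤ γ k t) (hτ : 0 ≤ τ)
    (X : Matrix (Fin m) (Fin m) ℂ) : traceNorm (exp (τ • drift H L γ t) X) ≤ traceNorm X := by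
  rw [exp_smul_drift_apply_eq_conj]
  have exp_norm_le := l2_opNorm_exp_smul_le_one (neg_generator_add_posSemidef (L := L) hH hγ) hτ
  exact (traceNorm_conj_le _ _).trans
    (mul_le_of_le_one_left (traceNorm_nonneg _) (pow_le_one₀ (norm_nonneg _) exp_norm_le))

theorem traceNorm_jump_le (hγ : ∀ k, ∀ t ∈ Icc 0 T, 0 ≤ γ k t)
    (hγc : ∀ k, ContinuousOn (γ k) (Icc 0 T)) (ht : t ∈ Icc 0 T) (X : Matrix (Fin m) (Fin m) ℂ) :
    traceNorm (jump L γ t X) ≤ stabilityConst L γ T * traceNorm X := by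
  rw [jump_apply, stabilityConst, Finset.sum_mul]
  refine (traceNorm_sum_le _ _).trans (Finset.sum_le_sum fun k _ => ?_)
  have rate_le : γ k t ≤ sSup (γ k '' Icc 0 T) :=
    le_csSup (isCompact_Icc.image_of_continuousOn (hγc k)).bddAbove (mem_image_of_mem _ ht)
  have conj_le : traceNorm (L k * X * (L k)ᴴ) ≤ traceNorm (L k) ^ 2 * traceNorm X := by
    grw [traceNorm_conj_le, l2_opNorm_le_traceNorm]
    exact traceNorm_nonneg X
  grw [traceNorm_smul_le, Real.norm_of_nonneg (hγ k t ht), conj_le, rate_le, mul_assoc]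
  · exact mul_nonneg (sq_nonneg _) (traceNorm_nonneg X)
  · exact hγ k t ht

variable (m) in
/-- The trace norm as a bundled seminorm. -/
noncomputable def traceSeminorm : Seminorm ℝ (Matrix (Fin m) (Fin m) ℂ) :=
  Seminorm.ofSMulLE traceNorm traceNorm_zero traceNorm_add_le traceNorm_smul_le

theorem traceNorm_fremStep_le (hH : ∀ t ∈ Icc 0 T, (H t).IsHermitian)
    (hγ : ∀ k, ∀ t ∈ Icc 0 T, 0 ≤ γ k t) (hγc : ∀ k, ContinuousOn (γ k) (Icc 0 T)) (ht : 0 ≤ t)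
    (hτ : 0 ≤ τ) (htT : t + τ ≤ T) (X : Matrix (Fin m) (Fin m) ℂ) :
    traceNorm (fremStep H L γ τ t X) ≤ Real.exp (stabilityConst L γ T * τ) * traceNorm X := by
  have left_mem : t ∈ Icc 0 T := ⟨ht, by linarith⟩
  have mid_mem : t + τ / 2 ∈ Icc 0 T := ⟨by linarith, by linarith⟩
  rw [fremStep_eq_expMidpointStep]
  exact seminorm_expMidpointStep_le (traceSeminorm m) (stabilityConst_nonneg hγ) hτ
    (fun _ hσ => traceNorm_exp_smul_drift_le (hH _ mid_mem) (fun k => hγ k _ mid_mem) hσ)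
    (traceNorm_jump_le hγ hγc mid_mem)
    (fun _ hσ => traceNorm_exp_smul_drift_le (hH _ left_mem) (fun k => hγ k _ left_mem) hσ)
    (traceNorm_jump_le hγ hγc left_mem) X

theorem contDiffOn_generator {s : Set ℝ} (hH : ContDiffOn ℝ 2 H s)
    (hγ : ∀ k, ContDiffOn ℝ 2 (γ k) s) : ContDiffOn ℝ 2 (generator H L γ) s := by
  have smooth_sum : ContDiffOn ℝ 2 (fun t => ∑ k, (γ k t : ℂ) • ((L k)ᴴ * L k)) s :=
    ContDiffOn.sum fun k _ =>
      (Complex.ofRealCLM.contDiff.comp_contDiffOn (hγ k)).smul contDiffOn_const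
  exact (hH.const_smul (-Complex.I)).sub (smooth_sum.const_smul (1 / 2 : ℂ))

theorem contDiffOn_drift {s : Set ℝ} (hH : ContDiffOn ℝ 2 H s)
    (hγ : ∀ k, ContDiffOn ℝ 2 (γ k) s) : ContDiffOn ℝ 2 (drift H L γ) s := by
  have smooth := contDiffOn_generator (L := L) hH hγ
  have smooth_adjoint : ContDiffOn ℝ 2 (fun t => (generator H L γ t)ᴴ) s :=
    (starL' ℝ).contDiff.comp_contDiffOn smooth
  let leftMul := ContinuousLinearMap.mul ℝ (Matrix (Fin m) (Fin m) ℂ)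
  exact (leftMul.contDiff.comp_contDiffOn smooth).add
    (leftMul.flip.contDiff.comp_contDiffOn smooth_adjoint)

theorem contDiffOn_jump {s : Set ℝ} (hγ : ∀ k, ContDiffOn ℝ 2 (γ k) s) :
    ContDiffOn ℝ 2 (jump L γ) s :=
  ContDiffOn.sum fun k _ => (hγ k).smul contDiffOn_const

theorem exists_traceNorm_sub_fremStep_le (hT : 0 < T) (hH : ∀ t ∈ Icc 0 T, (H t).IsHermitian)
    (hHsmooth : ContDiffOn ℝ 2 H (Icc 0 T)) (hγsmooth : ∀ k, ContDiffOn ℝ 2 (γ k) (Icc 0 T))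
    (M : ℝ) : ∃ C > 0, ∀ (t τ : ℝ) (ρ : ℝ → Matrix (Fin m) (Fin m) ℂ), 0 ≤ t → 0 ≤ τ → t + τ ≤ T →
      IsLindbladSolution H L γ t (t + τ) ρ → traceNorm (ρ t) ≤ M →
      traceNorm (ρ (t + τ) - fremStep H L γ τ t (ρ t)) ≤ C * τ ^ 3 := by
  obtain ⟨C, hC⟩ := exists_norm_flow_sub_expMidpointStep_le hT
    (contDiffOn_drift (L := L) hHsmooth hγsmooth) (contDiffOn_jump (L := L) hγsmooth) M
  refine ⟨m * |C| + 1, by positivity, fun t τ ρ ht hτ htT hρ hM => ?_⟩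
  have norm_le := hC t τ ρ ht hτ htT (fun u hu => by
    rw [← lindbladRHS_eq (hH u ⟨ht.trans hu.1, hu.2.trans htT⟩)]
    exact hasDerivWithinAt_of_entries (hρ u hu)) ((l2_opNorm_le_traceNorm _).trans hM)
  rw [← fremStep_eq_expMidpointStep] at norm_le
  calc traceNorm (ρ (t + τ) - fremStep H L γ τ t (ρ t))
      ≤ m * ‖ρ (t + τ) - fremStep H L γ τ t (ρ t)‖ := traceNorm_le_mul_l2_opNorm _
    _ ≤ m * (C * τ ^ 3) := by gcongr
    _ ≤ m * (|C| * τ ^ 3) := by gcongr; exact le_abs_self C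
    _ ≤ (m * |C| + 1) * τ ^ 3 := by linarith [pow_nonneg hτ 3]

end Step

section Recursion

theorem le_mul_geom_sum {e : ℕ → ℝ} {a d : ℝ} {n : ℕ} (ha : 0 ≤ a) (e_zero : e 0 ≤ 0)
    (e_succ : ∀ k < n, e (k + 1) ≤ a * e k + d) : e n ≤ d * ∑ i ∈ Finset.range n, a ^ i := by
  induction n with
  | zero => simpa using e_zero
  | succ n ih =>
    calc e (n + 1) ≤ a * e n + d := e_succ n n.lt_succ_self
      _ ≤ a * (d * ∑ i ∈ Finset.range n, a ^ i) + d := by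
        gcongr
        exact ih fun k hk => e_succ k (hk.trans n.lt_succ_self)
      _ = d * ∑ i ∈ Finset.range (n + 1), a ^ i := by rw [geom_sum_succ]; ring

theorem geom_sum_exp_mul_le {c τ T : ℝ} {n : ℕ} (hc : 0 ≤ c) (hn : n * τ ≤ T) :
    (∑ i ∈ Finset.range n, Real.exp (c * τ) ^ i) * (c * τ) ≤ Real.exp (c * T) - 1 :=
  calc (∑ i ∈ Finset.range n, Real.exp (c * τ) ^ i) * (c * τ)
      ≤ (∑ i ∈ Finset.range n, Real.exp (c * τ) ^ i) * (Real.exp (c * τ) - 1) := by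
        gcongr
        linarith [Real.add_one_le_exp (c * τ)]
    _ = Real.exp (c * (n * τ)) - 1 := by rw [geom_sum_mul, ← Real.exp_nat_mul, mul_left_comm]
    _ ≤ Real.exp (c * T) - 1 := by gcongr

theorem geom_sum_le_errorConst {C₁ C₂ τ T : ℝ} {n : ℕ} (hC₁ : 0 ≤ C₁) (hC₂ : 0 ≤ C₂)
    (hn : n * τ ≤ T) :
    C₁ * τ ^ 3 * ∑ i ∈ Finset.range n, Real.exp (C₂ * τ) ^ i ≤ errorConst C₁ C₂ T * τ ^ 2 := by
  unfold errorConst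
  split_ifs with hC₂_zero
  · calc C₁ * τ ^ 3 * ∑ i ∈ Finset.range n, Real.exp (C₂ * τ) ^ i = C₁ * (n * τ) * τ ^ 2 := by
          simp only [hC₂_zero, zero_mul, Real.exp_zero, one_pow, Finset.sum_const,
            Finset.card_range, nsmul_eq_mul, mul_one]
          ring
      _ ≤ C₁ * T * τ ^ 2 := by gcongr
  · calc C₁ * τ ^ 3 * ∑ i ∈ Finset.range n, Real.exp (C₂ * τ) ^ i
        = C₁ / C₂ * ((∑ i ∈ Finset.range n, Real.exp (C₂ * τ) ^ i) * (C₂ * τ)) * τ ^ 2 := by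
          field_simp
      _ ≤ C₁ / C₂ * (Real.exp (C₂ * T) - 1) * τ ^ 2 := by
          gcongr
          exact geom_sum_exp_mul_le hC₂ hn

end Recursion

section Global

variable {m K : ℕ} {H : ℝ → Matrix (Fin m) (Fin m) ℂ} {L : Fin K → Matrix (Fin m) (Fin m) ℂ}
  {γ : Fin K → ℝ → ℝ} {T t τ : ℝ} {X : Matrix (Fin m) (Fin m) ℂ} {n : ℕ}
  {ρ : ℝ → Matrix (Fin m) (Fin m) ℂ}

theorem IsLindbladSolution.mono {a b c d : ℝ} (hρ : IsLindbladSolution H L γ a b ρ) (hac : a ≤ c)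
    (hdb : d ≤ b) : IsLindbladSolution H L γ c d ρ :=
  fun t ht i j => (hρ t (Icc_subset_Icc hac hdb ht) i j).mono (Icc_subset_Icc hac hdb)

theorem IsLindbladSolution.continuousOn {a b : ℝ} (hρ : IsLindbladSolution H L γ a b ρ) :
    ContinuousOn ρ (Icc a b) :=
  fun t ht => (hasDerivWithinAt_of_entries (hρ t ht)).continuousWithinAt

theorem IsLindbladSolution.exists_traceNorm_le {a b : ℝ} (hρ : IsLindbladSolution H L γ a b ρ) :
    ∃ M, ∀ t ∈ Icc a b, traceNorm (ρ t) ≤ M := by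
  obtain ⟨M, hM⟩ := isCompact_Icc.exists_bound_of_continuousOn hρ.continuousOn
  refine ⟨m * M, fun t ht => (traceNorm_le_mul_l2_opNorm _).trans ?_⟩
  gcongr
  exact hM t ht

theorem trace_lindbladRHS (X : Matrix (Fin m) (Fin m) ℂ) : (lindbladRHS H L γ t X).trace = 0 := by
  have commutator_trace : (H t * X - X * H t).trace = 0 := by
    rw [trace_sub, trace_mul_comm, sub_self]
  have dissipator_trace (k : Fin K) : (L k * X * (L k)ᴴ -
      (1 / 2 : ℂ) • ((L k)ᴴ * L k * X + X * ((L k)ᴴ * L k))).trace = 0 := by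
    rw [trace_sub, trace_smul, trace_add, trace_mul_comm (L k * X), ← mul_assoc, trace_mul_comm X,
      smul_eq_mul]
    ring
  simp only [lindbladRHS, trace_add, trace_smul, trace_sum, commutator_trace, dissipator_trace,
    smul_zero, Finset.sum_const_zero, add_zero]

theorem IsLindbladSolution.trace_eq {a b : ℝ} (hρ : IsLindbladSolution H L γ a b ρ)
    (ht : t ∈ Icc a b) : (ρ t).trace = (ρ a).trace := by
  have deriv_trace : ∀ u ∈ Icc a b, HasDerivWithinAt (fun s => (ρ s).trace) 0 (Icc a b) u :=
    fun u hu => by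
      rw [← trace_lindbladRHS (H := H) (L := L) (γ := γ) (t := u) (ρ u)]
      exact HasDerivWithinAt.fun_sum fun i _ => hρ u hu i i
  have norm_le := (convex_Icc a b).norm_image_sub_le_of_norm_hasDerivWithin_le (C := 0) deriv_trace
    (by simp) (left_mem_Icc.2 (ht.1.trans ht.2)) ht
  rwa [zero_mul, norm_le_zero_iff, sub_eq_zero] at norm_le

variable (H L γ τ X) in
/-- The FREM scheme without normalization on the grid `tₙ = n τ`. It is linear in the initial value,
and normalizing its `n`-th iterate gives `normalizedFREM`. -/
noncomputable def unnormalizedFREM : ℕ → Matrix (Fin m) (Fin m) ℂ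
  | 0 => X
  | n + 1 => fremStep H L γ τ (n * τ) (unnormalizedFREM n)

theorem add_le_of_succ_mul_le (hn : (n + 1 : ℕ) * τ ≤ T) : n * τ + τ ≤ T := by
  rwa [Nat.cast_succ, add_one_mul] at hn

theorem unnormalizedFREM_posSemidef (hγ : ∀ k, ∀ t ∈ Icc 0 T, 0 ≤ γ k t) (hτ : 0 ≤ τ)
    (hX : X.PosSemidef) (hn : n * τ ≤ T) : (unnormalizedFREM H L γ τ X n).PosSemidef := by
  induction n with
  | zero => exact hX
  | succ n ih =>
    have step_le := add_le_of_succ_mul_le hn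
    have node_nonneg : 0 ≤ n * τ := by positivity
    exact fremStep_posSemidef hτ (fun k => hγ k _ ⟨node_nonneg, by linarith⟩)
      (fun k => hγ k _ ⟨by linarith, by linarith⟩) (ih (by linarith))

theorem unnormalizedFREM_ne_zero (hγ : ∀ k, ∀ t ∈ Icc 0 T, 0 ≤ γ k t) (hτ : 0 ≤ τ)
    (hX : X.PosSemidef) (hX₀ : X ≠ 0) (hn : n * τ ≤ T) : unnormalizedFREM H L γ τ X n ≠ 0 := by
  induction n with
  | zero => exact hX₀
  | succ n ih =>
    have step_le := add_le_of_succ_mul_le hn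
    have node_nonneg : 0 ≤ n * τ := by positivity
    have node_le : n * τ ≤ T := by linarith
    exact fremStep_ne_zero hτ (fun k => hγ k _ ⟨node_nonneg, node_le⟩)
      (fun k => hγ k _ ⟨by linarith, by linarith⟩) (unnormalizedFREM_posSemidef hγ hτ hX node_le)
      (ih node_le)

theorem IsDensity.trace_unnormalizedFREM_ne_zero (hX : IsDensity X)
    (hγ : ∀ k, ∀ t ∈ Icc 0 T, 0 ≤ γ k t) (hτ : 0 ≤ τ) (hn : n * τ ≤ T) :
    (unnormalizedFREM H L γ τ X n).trace ≠ 0 := by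
  have start_ne_zero : X ≠ 0 := fun hX₀ => by simpa [hX₀] using hX.2
  rw [Ne, (unnormalizedFREM_posSemidef hγ hτ hX.1 hn).trace_eq_zero_iff]
  exact unnormalizedFREM_ne_zero hγ hτ hX.1 start_ne_zero hn

theorem IsDensity.normalizedFREM_eq (hX : IsDensity X) (hγ : ∀ k, ∀ t ∈ Icc 0 T, 0 ≤ γ k t)
    (hτ : 0 ≤ τ) (hn : n * τ ≤ T) : normalizedFREM H L γ τ X n =
      (unnormalizedFREM H L γ τ X n).trace⁻¹ • unnormalizedFREM H L γ τ X n := by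
  induction n with
  | zero => simp [normalizedFREM, unnormalizedFREM, hX.2]
  | succ n ih =>
    have node_le : n * τ ≤ T := by linarith [add_le_of_succ_mul_le hn]
    have scale_ne_zero :=
      inv_ne_zero (hX.trace_unnormalizedFREM_ne_zero (H := H) (L := L) hγ hτ node_le)
    rw [normalizedFREM, ih node_le, fremStep_smul, trace_smul, smul_smul, smul_eq_mul, mul_inv,
      mul_right_comm, inv_mul_cancel₀ scale_ne_zero, one_mul, unnormalizedFREM]

theorem traceNorm_sub_unnormalizedFREM_le {C : ℝ} (hH : ∀ t ∈ Icc 0 T, (H t).IsHermitian)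
    (hγ : ∀ k, ∀ t ∈ Icc 0 T, 0 ≤ γ k t) (hγc : ∀ k, ContinuousOn (γ k) (Icc 0 T)) (hC : 0 ≤ C)
    (hτ : 0 ≤ τ) (hn : n * τ ≤ T) (local_error_le : ∀ k < n,
      traceNorm (ρ (k * τ + τ) - fremStep H L γ τ (k * τ) (ρ (k * τ))) ≤ C * τ ^ 3) :
    traceNorm (ρ (n * τ) - unnormalizedFREM H L γ τ (ρ 0) n) ≤
      errorConst C (stabilityConst L γ T) T * τ ^ 2 := by
  have error_zero :
      traceNorm (ρ ((0 : ℕ) * τ) - unnormalizedFREM H L γ τ (ρ 0) 0) ≤ 0 := by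
    simp [unnormalizedFREM, traceNorm_zero]
  refine (le_mul_geom_sum (a := Real.exp (stabilityConst L γ T * τ))
    (e := fun k => traceNorm (ρ (k * τ) - unnormalizedFREM H L γ τ (ρ 0) k))
    (Real.exp_nonneg _) error_zero fun k hk => ?_).trans
    (geom_sum_le_errorConst hC (stabilityConst_nonneg hγ) hn)
  have step_le : k * τ + τ ≤ T := by
    refine add_le_of_succ_mul_le (le_trans ?_ hn)
    gcongr
    exact hk
  have error_succ : ρ ((k + 1 : ℕ) * τ) - unnormalizedFREM H L γ τ (ρ 0) (k + 1) =
      fremStep H L γ τ (k * τ) (ρ (k * τ) - unnormalizedFREM H L γ τ (ρ 0) k) +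
        (ρ (k * τ + τ) - fremStep H L γ τ (k * τ) (ρ (k * τ))) := by
    rw [fremStep_sub, unnormalizedFREM, Nat.cast_succ, add_one_mul]
    abel
  rw [error_succ]
  exact (traceNorm_add_le _ _).trans (add_le_add
    (traceNorm_fremStep_le hH hγ hγc (by positivity) hτ step_le _) (local_error_le k hk))

theorem natCast_mul_div_le {N : ℕ} (hT : 0 ≤ T) (hN : 0 < N) (hn : n ≤ N) : n * (T / N) ≤ T :=
  calc n * (T / N) ≤ N * (T / N) := by gcongr
    _ = T := by field_simp

theorem IsLindbladSolution.exists_norm_sub_unnormalizedFREM_le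
    (hT : 0 < T) (hH : ∀ t ∈ Icc 0 T, (H t).IsHermitian) (hγ : ∀ k, ∀ t ∈ Icc 0 T, 0 ≤ γ k t)
    (hHsmooth : ContDiffOn ℝ 2 H (Icc 0 T)) (hγsmooth : ∀ k, ContDiffOn ℝ 2 (γ k) (Icc 0 T))
    (hρ : IsLindbladSolution H L γ 0 T ρ) : ∃ D, ∀ (τ : ℝ) (n : ℕ), 0 ≤ τ → n * τ ≤ T →
      ‖ρ (n * τ) - unnormalizedFREM H L γ τ (ρ 0) n‖ ≤ D * τ ^ 2 := by
  obtain ⟨M, hM⟩ := hρ.exists_traceNorm_le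
  obtain ⟨C, hC, local_error_le⟩ :=
    exists_traceNorm_sub_fremStep_le (L := L) hT hH hHsmooth hγsmooth M
  refine ⟨errorConst C (stabilityConst L γ T) T, fun τ n hτ hn =>
    (l2_opNorm_le_traceNorm _).trans (traceNorm_sub_unnormalizedFREM_le hH hγ
      (fun k => (hγsmooth k).continuousOn) hC.le hτ hn fun k hk => ?_)⟩
  have node_nonneg : 0 ≤ k * τ := by positivity
  have step_le : k * τ + τ ≤ T := by
    refine add_le_of_succ_mul_le (le_trans ?_ hn)
    gcongr
    exact hk
  exact local_error_le _ _ ρ node_nonneg hτ step_le (hρ.mono node_nonneg step_le)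
    (hM _ ⟨node_nonneg, by linarith⟩)

/-- Positivity is inherited from the positive approximations with step sizes `t / (j + 1)`. -/
theorem IsLindbladSolution.posSemidef
    (hT : 0 < T) (hH : ∀ t ∈ Icc 0 T, (H t).IsHermitian) (hγ : ∀ k, ∀ t ∈ Icc 0 T, 0 ≤ γ k t)
    (hHsmooth : ContDiffOn ℝ 2 H (Icc 0 T)) (hγsmooth : ∀ k, ContDiffOn ℝ 2 (γ k) (Icc 0 T))
    (hρ : IsLindbladSolution H L γ 0 T ρ) (hρ₀ : (ρ 0).PosSemidef) (ht : t ∈ Icc 0 T) :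
    (ρ t).PosSemidef := by
  obtain ⟨D, error_le⟩ :=
    hρ.exists_norm_sub_unnormalizedFREM_le hT hH hγ hHsmooth hγsmooth
  let τ (j : ℕ) : ℝ := t / (j + 1)
  have τ_nonneg (j : ℕ) : 0 ≤ τ j := div_nonneg ht.1 (by positivity)
  have end_eq (j : ℕ) : (j + 1 : ℕ) * τ j = t := by
    rw [Nat.cast_succ]
    exact mul_div_cancel₀ t (by positivity)
  have end_le (j : ℕ) : (j + 1 : ℕ) * τ j ≤ T := (end_eq j).trans_le ht.2
  have τ_tendsto : Tendsto τ atTop (nhds 0) := tendsto_const_div_atTop_nhds_zero_nat t |>.comp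
    (tendsto_add_atTop_nat 1) |>.congr fun j => by simp [τ]
  have approx_tendsto :
      Tendsto (fun j => unnormalizedFREM H L γ (τ j) (ρ 0) (j + 1)) atTop (nhds (ρ t)) := by
    rw [tendsto_iff_norm_sub_tendsto_zero]
    refine squeeze_zero (fun _ => norm_nonneg _) (fun j => ?_)
      (by simpa using (τ_tendsto.pow 2).const_mul D)
    rw [norm_sub_rev]
    simpa only [end_eq] using error_le (τ j) (j + 1) (τ_nonneg j) (end_le j)
  exact isClosed_setOf_posSemidef.mem_of_tendsto approx_tendsto (.of_forall fun j =>
    unnormalizedFREM_posSemidef hγ (τ_nonneg j) hρ₀ (end_le j))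

theorem IsLindbladSolution.isDensity
    (hT : 0 < T) (hH : ∀ t ∈ Icc 0 T, (H t).IsHermitian) (hγ : ∀ k, ∀ t ∈ Icc 0 T, 0 ≤ γ k t)
    (hHsmooth : ContDiffOn ℝ 2 H (Icc 0 T)) (hγsmooth : ∀ k, ContDiffOn ℝ 2 (γ k) (Icc 0 T))
    (hρ : IsLindbladSolution H L γ 0 T ρ) (hρ₀ : IsDensity (ρ 0)) (ht : t ∈ Icc 0 T) :
    IsDensity (ρ t) :=
  ⟨hρ.posSemidef hT hH hγ hHsmooth hγsmooth hρ₀.1 ht, (hρ.trace_eq ht).trans hρ₀.2⟩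

theorem exists_isTruncationConst (hT : 0 < T) (hH : ∀ t ∈ Icc 0 T, (H t).IsHermitian)
    (hHsmooth : ContDiffOn ℝ 2 H (Icc 0 T)) (hγsmooth : ∀ k, ContDiffOn ℝ 2 (γ k) (Icc 0 T)) :
    ∃ C > 0, IsTruncationConst H L γ T C := by
  obtain ⟨C, hC, local_error_le⟩ :=
    exists_traceNorm_sub_fremStep_le (L := L) hT hH hHsmooth hγsmooth 1
  refine ⟨C, hC, fun N hN n hn ρ hρ hd => ?_⟩
  rw [add_one_mul] at hρ ⊢
  exact local_error_le _ _ ρ (by positivity) (by positivity)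
    (add_le_of_succ_mul_le (natCast_mul_div_le hT.le hN hn)) hρ hd.traceNorm_le

theorem IsTruncationConst.nonneg {C : ℝ} (hC : IsTruncationConst H L γ T C) (hT : 0 < T)
    (hρ : IsLindbladSolution H L γ 0 T ρ) (hρ₀ : IsDensity (ρ 0)) : 0 ≤ C := by
  have one_step := hC 1 one_pos 0 one_pos ρ (by simpa using hρ) (by simpa using hρ₀)
  exact nonneg_of_mul_nonneg_left ((traceNorm_nonneg _).trans one_step)
    (by simpa using pow_pos hT 3)

theorem IsTruncationConst.traceNorm_sub_unnormalizedFREM_le {C : ℝ} {N : ℕ}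
    (hC : IsTruncationConst H L γ T C) (hT : 0 < T) (hH : ∀ t ∈ Icc 0 T, (H t).IsHermitian)
    (hγ : ∀ k, ∀ t ∈ Icc 0 T, 0 ≤ γ k t) (hγc : ∀ k, ContinuousOn (γ k) (Icc 0 T))
    (hρ : IsLindbladSolution H L γ 0 T ρ) (hd : ∀ t ∈ Icc 0 T, IsDensity (ρ t))
    (hN : 0 < N) (hn : n ≤ N) :
    traceNorm (ρ (n * (T / N)) - unnormalizedFREM H L γ (T / N) (ρ 0) n) ≤
      errorConst C (stabilityConst L γ T) T * (T / N) ^ 2 := by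
  have C_nonneg : 0 ≤ C := hC.nonneg hT hρ (hd 0 (left_mem_Icc.2 hT.le))
  refine LindbladFREM.traceNorm_sub_unnormalizedFREM_le hH hγ hγc C_nonneg (by positivity)
    (natCast_mul_div_le hT.le hN hn) fun k hk => ?_
  have node_nonneg : 0 ≤ k * (T / N) := by positivity
  have k_lt : k < N := hk.trans_le hn
  have local_error_le := hC N hN k k_lt ρ
  rw [add_one_mul] at local_error_le
  exact local_error_le
    (hρ.mono node_nonneg (add_le_of_succ_mul_le (natCast_mul_div_le hT.le hN k_lt)))
    (hd _ ⟨node_nonneg, natCast_mul_div_le hT.le hN k_lt.le⟩)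

theorem traceNorm_sub_inv_trace_smul_le {R : Matrix (Fin m) (Fin m) ℂ} (hR : R.trace = 1)
    (hX : X.PosSemidef) (trace_ne_zero : X.trace ≠ 0) :
    traceNorm (R - X.trace⁻¹ • X) ≤ 2 * traceNorm (R - X) := by
  have rescaling_le : ‖1 - X.trace⁻¹‖ * traceNorm X ≤ traceNorm (R - X) :=
    calc ‖1 - X.trace⁻¹‖ * traceNorm X ≤ ‖1 - X.trace⁻¹‖ * ‖X.trace‖ := by
          gcongr
          exact traceNorm_le_norm_trace hX
      _ = ‖(R - X).trace‖ := by
          rw [← norm_mul, sub_mul, one_mul, inv_mul_cancel₀ trace_ne_zero, trace_sub, hR,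
            norm_sub_rev]
      _ ≤ traceNorm (R - X) := norm_trace_le _
  calc traceNorm (R - X.trace⁻¹ • X) = traceNorm ((R - X) + (1 - X.trace⁻¹) • X) := by
        congr 1
        module
    _ ≤ traceNorm (R - X) + ‖1 - X.trace⁻¹‖ * traceNorm X := by
        grw [traceNorm_add_le, traceNorm_smul_le]
    _ ≤ 2 * traceNorm (R - X) := by linarith

end Global

end LindbladFREM

open LindbladFREM in
theorem theorem3p2 {m K : ℕ} (H : ℝ → Matrix (Fin m) (Fin m) ℂ)
    (L : Fin K → Matrix (Fin m) (Fin m) ℂ) (γ : Fin K → ℝ → ℝ) (T : ℝ) (hT : 0 < T)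
    (hH : ∀ t ∈ Set.Icc 0 T, (H t).IsHermitian)
    (hγ : ∀ k, ∀ t ∈ Set.Icc 0 T, 0 ≤ γ k t)
    (hHsmooth : ∀ i j, ContDiffOn ℝ 2 (fun t => H t i j) (Set.Icc 0 T))
    (hγsmooth : ∀ k, ContDiffOn ℝ 2 (γ k) (Set.Icc 0 T)) :
    (∃ C₁ : ℝ, 0 < C₁ ∧ IsTruncationConst H L γ T C₁) ∧
    ∀ C₁ : ℝ, IsTruncationConst H L γ T C₁ →
      ∀ ρ : ℝ → Matrix (Fin m) (Fin m) ℂ,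
        IsLindbladSolution H L γ 0 T ρ → IsDensity (ρ 0) →
        ∀ N : ℕ, 0 < N → ∀ n : ℕ, n ≤ N →
          traceNorm (ρ (n * (T / N)) - normalizedFREM H L γ (T / N) (ρ 0) n)
            ≤ 2 * errorConst C₁ (stabilityConst L γ T) T * (T / N) ^ 2 := by
  have H_smooth := contDiffOn_of_entries hHsmooth
  refine ⟨exists_isTruncationConst hT hH H_smooth hγsmooth, fun C₁ hC₁ ρ hρ hρ₀ N hN n hn => ?_⟩
  have density (t : ℝ) (ht : t ∈ Set.Icc 0 T) : IsDensity (ρ t) :=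
    hρ.isDensity hT hH hγ H_smooth hγsmooth hρ₀ ht
  have τ_nonneg : 0 ≤ T / N := by positivity
  have node_le : n * (T / N) ≤ T := natCast_mul_div_le hT.le hN hn
  have node_mem : n * (T / N) ∈ Set.Icc 0 T := ⟨by positivity, node_le⟩
  set X := unnormalizedFREM H L γ (T / N) (ρ 0) n
  calc traceNorm (ρ (n * (T / N)) - normalizedFREM H L γ (T / N) (ρ 0) n)
      = traceNorm (ρ (n * (T / N)) - X.trace⁻¹ • X) := by
        rw [hρ₀.normalizedFREM_eq hγ τ_nonneg node_le]
    _ ≤ 2 * traceNorm (ρ (n * (T / N)) - X) :=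
        traceNorm_sub_inv_trace_smul_le (density _ node_mem).2
          (unnormalizedFREM_posSemidef hγ τ_nonneg hρ₀.1 node_le)
          (hρ₀.trace_unnormalizedFREM_ne_zero hγ τ_nonneg node_le)
    _ ≤ 2 * (errorConst C₁ (stabilityConst L γ T) T * (T / N) ^ 2) := by
        gcongr
        exact hC₁.traceNorm_sub_unnormalizedFREM_le hT hH hγ
          (fun k => (hγsmooth k).continuousOn) hρ density hN hn
    _ = 2 * errorConst C₁ (stabilityConst L γ T) T * (T / N) ^ 2 := (mul_assoc _ _ _).symm
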